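/- For a finite graph $G$ (loops and multiple edges allowed) with edge set $E$, put $P_G=\sum_T\prod_{e\notin T}x_e$ and $Q_G=\sum_T\prod_{e\in T}x_e$ in $\mathbb Z[x_e : e\in E]$, where $T$ runs over the spanning trees of $G$, and let $Y_G$ and $X_G$ be the complements in $\mathbb A^E_{\mathbb Z}$ of the hypersurfaces $P_G=0$ and $Q_G=0$. For a finite simple graph $G$ with vertices $v_1,\dots,v_n$, let $Z^o_G$ be the scheme of nondegenerate symmetric $n\times n$ matrices $M$ with $M_{ij}=0$ whenever $i\ne j$ and $v_i,v_j$ are not adjacent. For a scheme $X$ of finite type over $\mathbb Z$, let $[X]$ denote the function $q\mapsto \#X(\mathbb F_q)$ on the set of prime powers. For a matroid $M$ of rank $r$ with ground set $E_M$ and rank function $\rho$, let $[X(M)](q)$ be the number of representations of $M$ over $\mathbb F_q$, i.e. of maps $f:E_M\to\mathbb F_q^{\,r}$ such that $\dim\operatorname{span} f(S)=\rho(S)$ for all $S\subseteq E_M$; $M$ is representable over $\mathbb F_q$ if such a map exists. Then: 1. (Stembridge's conjecture is false.) There is a finite simple graph $G$ for which $[Z^o_G]$ is not a polynomial in $q$.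 2. (Stanley's conjecture is false.) There is a finite graph $G$ for which $[X_G]$ is not a polynomial in $q$. 3. (Kontsevich's conjecture is false.) There is a finite graph $G$ for which $[Y_G]$ is not a polynomial in $q$; in particular $[Y_G]\notin\mathbb Z[q]$. 4. The Fano matroid $F$, i.e. the matroid with ground set $\mathbb P^2(\mathbb F_2)$ given by linear independence over $\mathbb F_2$, has rank $3$; it is representable over $\mathbb F_q$ if and only if $2\mid q$; and $[X(F)]$ is not a rational function of $q$: there are no polynomials $a,b\in\mathbb Q[q]$, $b\neq0$, with $b(q)\,[X(F)](q)=a(q)$ for all prime powers $q$. In 1-3, "polynomial" means a polynomial with rational coefficients, so in particular no polynomial with integer coefficients works either. -/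

import Mathlib

open Polynomial

noncomputable section

namespace PointCount

/-! ### Counting functions on finite fields

The counting function `q ↦ #X(𝔽_q)` of a scheme `X` over `ℤ` is represented by the assignment
`K ↦ #X(K)` on all finite fields `K`; it depends on `q = #K` only. -/

/-- The counting function `N` is a polynomial in `q` with coefficients in `A`
(`A = ℤ` or `A = ℚ`). -/
def IsPolynomial (A : Type) [CommRing A] (N : (K : Type) → [Field K] → ℕ) : Prop :=
  ∃ p : A[X], ∀ (K : Type) [Field K] [Finite K], (N K : A) = p.eval (Nat.card K : A)

/-- Being a polynomial with integer coefficients is the stronger property. -/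
theorem IsPolynomial.int_to_rat {N : (K : Type) → [Field K] → ℕ} (h : IsPolynomial ℤ N) :
    IsPolynomial ℚ N := by
  obtain ⟨p, hp⟩ := h
  refine ⟨p.map (Int.castRingHom ℚ), fun K _ _ => ?_⟩
  have h1 := congrArg (Int.castRingHom ℚ) (hp K)
  have h2 := Polynomial.eval_map_apply (f := Int.castRingHom ℚ) (p := p) (Nat.card K : ℤ)
  simp only [eq_intCast, Int.cast_natCast] at h1 h2
  rw [h2, h1]

/-- The counting function `N` is a rational function `a / b` of `q`. The equation is cleared of
denominators, so nothing is required of `N` at the zeros of `b` except that `a` vanish there. -/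
def IsRational (N : (K : Type) → [Field K] → ℕ) : Prop :=
  ∃ a b : ℚ[X], b ≠ 0 ∧ ∀ (K : Type) [Field K] [Finite K],
    b.eval (Nat.card K : ℚ) * (N K : ℚ) = a.eval (Nat.card K : ℚ)

/-! ### Spanning trees of graphs with loops and multiple edges -/

section Graphs

variable {V E : Type}

/-- The number of connected components. -/
def bettiZero (G : Graph V E) : ℕ :=
  Nat.card (Quot fun x y : G.vertexSet => G.Adj x y)

/-- The first Betti number of a finite graph, from the Euler characteristic
`b₀ - b₁ = #vertices - #edges`. -/
def bettiOne (G : Graph V E) : ℤ :=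
  (bettiZero G : ℤ) - (G.vertexSet.ncard : ℤ) + (G.edgeSet.ncard : ℤ)

/-- A finite graph is a tree if `b₀ = 1` and `b₁ = 0`. -/
def IsTree (G : Graph V E) : Prop :=
  bettiZero G = 1 ∧ bettiOne G = 0

/-- The edge set `T` is that of a spanning tree: the subgraph of `G` with all the vertices of `G`
and the edges in `T` is a tree. -/
def IsSpanningTree (G : Graph V E) (T : Finset G.edgeSet) : Prop :=
  IsTree (G.restrict (Subtype.val '' (T : Set G.edgeSet)))

open Classical in
/-- Kontsevich's polynomial `P_G = ∑_T ∏_{e ∉ T} x_e`, over all spanning trees `T`. -/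
def polyP (G : Graph V E) [Fintype G.edgeSet] : MvPolynomial G.edgeSet ℤ :=
  ∑ T : Finset G.edgeSet with IsSpanningTree G T, ∏ e ∈ Tᶜ, MvPolynomial.X e

open Classical in
/-- Stanley's polynomial `Q_G = ∑_T ∏_{e ∈ T} x_e`, over all spanning trees `T`. -/
def polyQ (G : Graph V E) [Fintype G.edgeSet] : MvPolynomial G.edgeSet ℤ :=
  ∑ T : Finset G.edgeSet with IsSpanningTree G T, ∏ e ∈ T, MvPolynomial.X e

/-- `#Y_G(K)`, where `Y_G` is the complement of the hypersurface `P_G = 0`. -/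
def countY (G : Graph V E) [Fintype G.edgeSet] (K : Type) [Field K] : ℕ :=
  Nat.card {x : G.edgeSet → K // MvPolynomial.aeval x (polyP G) ≠ 0}

/-- `#X_G(K)`, where `X_G` is the complement of the hypersurface `Q_G = 0`. -/
def countX (G : Graph V E) [Fintype G.edgeSet] (K : Type) [Field K] : ℕ :=
  Nat.card {x : G.edgeSet → K // MvPolynomial.aeval x (polyQ G) ≠ 0}

end Graphs

/-- `#Z°_G(K)`: the number of nondegenerate symmetric matrices over `K` whose off-diagonal entries
vanish outside the edges of the simple graph `G`. -/
def countZo {n : ℕ} (G : SimpleGraph (Fin n)) (K : Type) [Field K] : ℕ :=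
  Nat.card {M : Matrix (Fin n) (Fin n) K //
    M.IsSymm ∧ M.det ≠ 0 ∧ ∀ i j, i ≠ j → ¬ G.Adj i j → M i j = 0}

/-! ### The three conjectures

For each of them, the coefficient ring of the polynomials is a parameter; the version for `ℤ`
implies the version for `ℚ`. -/

/-- `[Y_G] ∈ A[q]` for all finite graphs `G`. -/
def KontsevichConjecture (A : Type) [CommRing A] : Prop :=
  ∀ (V E : Type) [Finite V] [Finite E] (G : Graph V E) [Fintype G.edgeSet],
    IsPolynomial A (countY G)

/-- `[X_G] ∈ A[q]` for all finite graphs `G`. -/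
def StanleyConjecture (A : Type) [CommRing A] : Prop :=
  ∀ (V E : Type) [Finite V] [Finite E] (G : Graph V E) [Fintype G.edgeSet],
    IsPolynomial A (countX G)

/-- `[Z°_G] ∈ A[q]` for all finite simple graphs `G`. -/
def StembridgeConjecture (A : Type) [CommRing A] : Prop :=
  ∀ (n : ℕ) (G : SimpleGraph (Fin n)), IsPolynomial A (countZo G)

/-! ### Matroid representations and the Fano matroid -/

section Matroids

variable {α : Type}

/-- The representations of the matroid `M` in `K ^ s`: the maps `f` from the ground set to `K ^ s`
such that `f(X)` spans a space of dimension `ρ(X)`, for all subsets `X` of the ground set. -/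
def Representation (M : Matroid α) (s : ℕ) (K : Type) [Field K] : Type :=
  {f : M.E → (Fin s → K) // ∀ X : Set M.E,
    (Module.finrank K (Submodule.span K (f '' X)) : ℕ∞) = M.eRk (Subtype.val '' X)}

/-- The rank of `M` as a natural number. -/
def rank (M : Matroid α) : ℕ := M.eRank.toNat

/-- `M` has a representation over `K`, in the space of dimension the rank of `M`. -/
def IsRepresentable (M : Matroid α) (K : Type) [Field K] : Prop :=
  Nonempty (Representation M (rank M) K)

/-- `#X(M)(K)`: the number of representations of `M` in `K ^ r`, for `r` the rank of `M`. -/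
def countRepresentations (M : Matroid α) (K : Type) [Field K] : ℕ :=
  Nat.card (Representation M (rank M) K)

/-- The matroid of a finite family of vectors: a set of indices is independent if the vectors with
these indices are linearly independent. -/
def vectorMatroid [Finite α] (F : Type) [Field F] {W : Type} [AddCommGroup W] [Module F W]
    (v : α → W) : Matroid α :=
  (IndepMatroid.ofFinite (E := Set.univ) Set.finite_univ (fun I => LinearIndepOn F v I)
    (linearIndepOn_empty F v) (fun _ _ hJ hIJ => hJ.mono hIJ)
    (by
      intro I J hI hJ hlt
      by_contra! hcon
      have hspan : ∀ e ∈ J, v e ∈ Submodule.span F (v '' I) := by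
        intro e he
        by_cases heI : e ∈ I
        · exact Submodule.subset_span ⟨e, heI, rfl⟩
        · by_contra hv
          exact hcon e he heI (hI.insert hv)
      have hle : Submodule.span F (v '' J) ≤ Submodule.span F (v '' I) := by
        rw [Submodule.span_le]
        rintro _ ⟨e, he, rfl⟩
        exact hspan e he
      have hcard : ∀ S : Set α, LinearIndepOn F v S →
          Module.finrank F (Submodule.span F (v '' S)) = S.ncard := by
        intro S hS
        have := Fintype.ofFinite S
        have h := finrank_span_eq_card (R := F) (b := fun i : S => v i) hS
        rw [Set.image_eq_range, h, ← Nat.card_eq_fintype_card, Nat.card_coe_set_eq]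
      have : Module.Finite F (Submodule.span F (v '' I)) :=
        Module.Finite.span_of_finite F (Set.toFinite _)
      have := Submodule.finrank_mono hle
      rw [hcard J hJ, hcard I hI] at this
      omega)
    (fun _ _ => Set.subset_univ _)).matroid

/-- The Fano matroid: its ground set is the projective plane over the field with two elements, and
each point is represented by a nonzero vector on it. -/
def fanoMatroid : Matroid (Projectivization (ZMod 2) (Fin 3 → ZMod 2)) :=
  vectorMatroid (ZMod 2) Projectivization.rep

end Matroids

end PointCount

end

/-!
Bordering a symmetric matrix `A` of size `n` and rank `r` by `c` rows and columns to a nondegenerate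
symmetric matrix is possible in a number of ways that depends only on `n`, `r` and `c`, and that is
zero if `c < n - r`. So the counting function `[Z°]` of the join of `G` with a complete graph of
size `c` is a combination of the numbers of matrices of each rank supported on `G`, and the system
for varying `c` is triangular. If all `[Z°]` were rational, so would be the number of symmetric
matrices of rank `r` with support in `G`, and by Möbius inversion over the subgraphs of `G` the
number of those whose support is exactly `G`. But for `r = 2` and `G = K_{3,3,3}` such a matrix
exists only in characteristic two: its diagonal vanishes, so that a principal `3 × 3` minor is
`2 * a * b * c` with `a * b * c ≠ 0`.

By the matrix tree theorem, `[Z°]` of `G` is `[X]` of the join of `G` with a vertex. Inverting the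
coordinates identifies the parts of `X` and `Y` in the torus, and the strata where coordinates
vanish belong to deletions and contractions of the graph, so that each `[X]` is generated by the
`[Y]`.

In a representation of the Fano matroid, the three points that are not on a given frame are
its diagonal points. In coordinates they are `(0, 1, 1)`, `(1, 0, 1)` and `(1, 1, 0)`, and these are
dependent exactly in characteristic two.
-/

noncomputable section

namespace PointCount

theorem eq_zero_of_eval_card_eq_zero (p : ℕ) [Fact p.Prime] {a : ℚ[X]}
    (h : ∀ (K : Type) [Field K] [Finite K] [CharP K p], a.eval (Nat.card K : ℚ) = 0) : a = 0 := by
  have hinj : Function.Injective fun n : ℕ => ((p ^ (n + 1) : ℕ) : ℚ) := fun m n hmn =>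
    Nat.succ_injective (Nat.pow_right_injective (Fact.out : p.Prime).two_le
      (Nat.cast_injective hmn))
  refine a.eq_zero_of_infinite_isRoot ((Set.infinite_range_of_injective hinj).mono ?_)
  rintro _ ⟨n, rfl⟩
  have := h (GaloisField p (n + 1))
  rwa [GaloisField.card p (n + 1) n.succ_ne_zero] at this

theorem IsPolynomial.isRational {N : (K : Type) → [Field K] → ℕ} (h : IsPolynomial ℚ N) :
    IsRational N := by
  obtain ⟨p, hp⟩ := h
  exact ⟨p, 1, one_ne_zero, fun K _ _ => by rw [eval_one, one_mul, hp]⟩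

namespace IsRational

variable {N N' : (K : Type) → [Field K] → ℕ}

theorem congr (h : IsRational N) (e : ∀ (K : Type) [Field K] [Finite K], N' K = N K) :
    IsRational N' := by
  obtain ⟨a, b, hb, h⟩ := h
  exact ⟨a, b, hb, fun K _ _ => by rw [e, h]⟩

theorem const (c : ℕ) : IsRational fun _ _ => c :=
  ⟨C (c : ℚ), 1, one_ne_zero, by simp⟩

theorem card : IsRational fun K _ => Nat.card K :=
  ⟨X, 1, one_ne_zero, by simp⟩

theorem add (h : IsRational N) (h' : IsRational N') : IsRational fun K _ => N K + N' K := by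
  obtain ⟨a, b, hb, h⟩ := h
  obtain ⟨a', b', hb', h'⟩ := h'
  refine ⟨a * b' + a' * b, b * b', mul_ne_zero hb hb', fun K _ _ => ?_⟩
  simp only [eval_add, eval_mul, ← h, ← h', Nat.cast_add]
  ring

theorem of_add_right (h : IsRational fun K _ => N K + N' K) (h' : IsRational N') :
    IsRational N := by
  obtain ⟨a, b, hb, h⟩ := h
  obtain ⟨a', b', hb', h'⟩ := h'
  refine ⟨a * b' - a' * b, b * b', mul_ne_zero hb hb', fun K _ _ => ?_⟩
  simp only [eval_sub, eval_mul, ← h, ← h', Nat.cast_add]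
  ring

theorem mul (h : IsRational N) (h' : IsRational N') : IsRational fun K _ => N K * N' K := by
  obtain ⟨a, b, hb, h⟩ := h
  obtain ⟨a', b', hb', h'⟩ := h'
  refine ⟨a * a', b * b', mul_ne_zero hb hb', fun K _ _ => ?_⟩
  simp only [eval_mul, ← h, ← h', Nat.cast_mul]
  ring

theorem of_mul_right (h : IsRational fun K _ => N K * N' K) (h' : IsRational N')
    (hN' : ∀ (K : Type) [Field K] [Finite K], N' K ≠ 0) : IsRational N := by
  obtain ⟨a, b, hb, h⟩ := h
  obtain ⟨a', b', hb', h'⟩ := h'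
  have ha' : a' ≠ 0 := by
    rintro rfl
    refine hb' (eq_zero_of_eval_card_eq_zero 2 fun K _ _ _ => ?_)
    simpa [hN' K] using h' K
  refine ⟨a * b', b * a', mul_ne_zero hb ha', fun K _ _ => ?_⟩
  simp only [eval_mul, ← h, ← h', Nat.cast_mul]
  ring

end IsRational

/-- A property of counting functions that is stable under the rational operations. It expresses that
a counting function is rationally generated by others: it has every such property that they have. -/
structure IsRationallyClosed (P : ((K : Type) → [Field K] → ℕ) → Prop) : Prop where
  congr {N N' : (K : Type) → [Field K] → ℕ} (h : P N)
    (e : ∀ (K : Type) [Field K] [Finite K], N' K = N K) : P N'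
  const (c : ℕ) : P fun _ _ => c
  card : P fun K _ => Nat.card K
  add {N N' : (K : Type) → [Field K] → ℕ} (h : P N) (h' : P N') : P fun K _ => N K + N' K
  of_add_right {N N' : (K : Type) → [Field K] → ℕ} (h : P fun K _ => N K + N' K) (h' : P N') : P N
  mul {N N' : (K : Type) → [Field K] → ℕ} (h : P N) (h' : P N') : P fun K _ => N K * N' K
  of_mul_right {N N' : (K : Type) → [Field K] → ℕ} (h : P fun K _ => N K * N' K) (h' : P N')
    (hN' : ∀ (K : Type) [Field K] [Finite K], N' K ≠ 0) : P N

theorem isRationallyClosed_isRational : IsRationallyClosed IsRational where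
  congr := .congr
  const := .const
  card := .card
  add := .add
  of_add_right := .of_add_right
  mul := .mul
  of_mul_right := .of_mul_right

namespace IsRationallyClosed

variable {P : ((K : Type) → [Field K] → ℕ) → Prop} (hP : IsRationallyClosed P)
include hP

theorem card_sub_one : P fun K _ => Nat.card K - 1 :=
  hP.of_add_right (hP.congr hP.card fun _ _ _ => Nat.sub_add_cancel Finite.card_pos) (hP.const 1)

theorem pow {N : (K : Type) → [Field K] → ℕ} (h : P N) (n : ℕ) : P fun K _ => N K ^ n := by
  induction n with
  | zero => exact hP.congr (hP.const 1) fun K _ _ => pow_zero _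
  | succ n ih => exact hP.congr (hP.mul ih h) fun K _ _ => pow_succ _ _

theorem sum {ι : Type*} (s : Finset ι) {F : ι → (K : Type) → [Field K] → ℕ}
    (h : ∀ i ∈ s, P (F i)) : P fun K _ => ∑ i ∈ s, F i K := by
  classical
  induction s using Finset.induction_on with
  | empty => exact hP.congr (hP.const 0) fun K _ _ => Finset.sum_empty
  | insert i s hi ih =>
    rw [Finset.forall_mem_insert] at h
    exact hP.congr (hP.add h.1 (ih h.2)) fun K _ _ => Finset.sum_insert hi

end IsRationallyClosed

theorem not_isRational_of_ne_zero_iff_charP (p : ℕ) [Fact p.Prime]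
    {N : (K : Type) → [Field K] → ℕ}
    (h : ∀ (K : Type) [Field K] [Finite K], N K ≠ 0 ↔ CharP K p) : ¬ IsRational N := by
  rintro ⟨a, b, hb, hab⟩
  obtain ⟨l, hpl, hl⟩ := Nat.exists_infinite_primes (p + 1)
  have := Fact.mk hl
  have ha : a = 0 := eq_zero_of_eval_card_eq_zero l fun K _ _ _ => by
    have hK : N K = 0 := by
      by_contra hK
      have := CharP.eq K ((h K).1 hK) ‹CharP K l›
      lia
    rw [← hab K, hK, Nat.cast_zero, mul_zero]
  refine hb (eq_zero_of_eval_card_eq_zero p fun K _ _ _ => ?_)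
  have hK : (N K : ℚ) ≠ 0 := Nat.cast_ne_zero.2 ((h K).2 ‹_›)
  simpa [ha, hK] using hab K

open Matrix

section BilinForm

variable {K : Type*} [Field K]

theorem exists_basis_toMatrix_eq_fromBlocks {V : Type*} [AddCommGroup V] [Module K V]
    [FiniteDimensional K V] {B : LinearMap.BilinForm K V} (hB : B.IsSymm) {r k : ℕ}
    (hk : Module.finrank K (LinearMap.ker B) = k) (hrk : r + k = Module.finrank K V) :
    ∃ (b : Module.Basis (Fin r ⊕ Fin k) K V) (M : Matrix (Fin r) (Fin r) K),
      M.IsSymm ∧ M.det ≠ 0 ∧ B.toMatrix b = fromBlocks M 0 0 0 := by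
  obtain ⟨W, hW⟩ := (LinearMap.ker B).exists_isCompl
  have hr : Module.finrank K W = r := by
    have := Submodule.finrank_add_eq_of_isCompl hW
    lia
  let bW := Module.finBasisOfFinrankEq K W hr
  let b := (bW.prod (Module.finBasisOfFinrankEq K _ hk)).map
    (Submodule.prodEquivOfIsCompl W _ hW.symm)
  have hker : ∀ x j, B (b (Sum.inr j)) x = 0 := fun x j => by
    have : b (Sum.inr j) ∈ LinearMap.ker B := by simp [b]
    rw [LinearMap.mem_ker.1 this, LinearMap.zero_apply]
  refine ⟨b, (B.restrict W).toMatrix bW, ?_, ?_, ?_⟩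
  · exact ((B.restrict W).isSymm_toMatrix_iff_isSymm bW).2 (hB.restrict W)
  · exact (LinearMap.BilinForm.nondegenerate_iff_det_ne_zero bW).1
      ((LinearMap.BilinForm.isSymm_iff.1 hB).nondegenerate_restrict_of_isCompl_ker hW.symm)
  · ext (i | i) (j | j)
    · simp [LinearMap.BilinForm.toMatrix_apply, b]
    · simp [LinearMap.BilinForm.toMatrix_apply, ← hB.eq (b (Sum.inr j)), hker]
    · simp [LinearMap.BilinForm.toMatrix_apply, hker]
    · simp [LinearMap.BilinForm.toMatrix_apply, hker]

variable {ι : Type*} [Fintype ι] [DecidableEq ι]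

theorem ker_toBilin'_of_isSymm {A : Matrix ι ι K} (hA : A.IsSymm) :
    LinearMap.ker A.toBilin' = LinearMap.ker A.mulVecLin := by
  ext x
  simp only [LinearMap.mem_ker, LinearMap.ext_iff, toBilin'_apply', LinearMap.zero_apply,
    mulVecLin_apply, dotProduct_mulVec, dotProduct_eq_zero_iff, ← mulVec_transpose, hA.eq]

theorem exists_transpose_mul_mul_eq_fromBlocks {A : Matrix ι ι K} (hA : A.IsSymm) {k : ℕ}
    (hk : A.rank + k = Fintype.card ι) :
    ∃ (Q : Matrix ι ι K) (e : Fin A.rank ⊕ Fin k ≃ ι) (M : Matrix (Fin A.rank) (Fin A.rank) K),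
      Q.det ≠ 0 ∧ M.IsSymm ∧ M.det ≠ 0 ∧
      (Qᵀ * A * Q).submatrix e e = fromBlocks M 0 0 0 := by
  have hker : Module.finrank K (LinearMap.ker A.toBilin') = k := by
    have := A.mulVecLin.finrank_range_add_finrank_ker
    rw [Module.finrank_fintype_fun_eq_card, ← hk] at this
    rw [ker_toBilin'_of_isSymm hA]
    exact Nat.add_left_cancel this
  obtain ⟨b, M, hM, hM', hb⟩ := exists_basis_toMatrix_eq_fromBlocks
    (isSymm_toBilin'_iff_isSymm.2 hA) hker (hk.trans (Module.finrank_fintype_fun_eq_card K).symm)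
  let e := b.indexEquiv (Pi.basisFun K ι)
  let Q := (Pi.basisFun K ι).toMatrix (b.reindex e)
  have hQ : IsUnit Q.det := by
    have := (Pi.basisFun K ι).invertibleToMatrix (b.reindex e)
    exact isUnit_det_of_invertible Q
  refine ⟨Q, e, M, hQ.ne_zero, hM, hM', ?_⟩
  have hcongr := LinearMap.BilinForm.toMatrix_mul_basis_toMatrix (Pi.basisFun K ι) (b.reindex e)
    A.toBilin'
  rw [LinearMap.BilinForm.toMatrix_basisFun, LinearMap.BilinForm.toMatrix'_toBilin'] at hcongr
  rw [hcongr, ← hb]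
  ext i j
  simp [LinearMap.BilinForm.toMatrix_apply]

end BilinForm

section Border

variable {K : Type*} [Field K]
variable {ι κ α β : Type*} [Fintype ι] [DecidableEq ι] [Fintype κ] [DecidableEq κ]
  [Fintype α] [DecidableEq α] [Fintype β] [DecidableEq β]

/-- The number of ways to border the symmetric matrix `A` by rows and columns with indices in `κ`
so that the result is symmetric and nondegenerate. -/
def borderCount (A : Matrix ι ι K) (κ : Type*) [Fintype κ] [DecidableEq κ] : ℕ :=
  Nat.card {p : Matrix ι κ K × Matrix κ κ K //
    p.2.IsSymm ∧ (fromBlocks A p.1 p.1ᵀ p.2).det ≠ 0}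

theorem borderCount_transpose_mul_mul (A : Matrix ι ι K) {Q : Matrix ι ι K} (hQ : Q.det ≠ 0) :
    borderCount (Qᵀ * A * Q) κ = borderCount A κ := by
  have hQt : IsUnit Qᵀ.det := by rwa [det_transpose, isUnit_iff_ne_zero]
  let mulLeft : Matrix ι κ K ≃ Matrix ι κ K :=
    { toFun := fun C => Qᵀ * C
      invFun := fun C => Qᵀ⁻¹ * C
      left_inv := (nonsing_inv_mul_cancel_left _ · hQt)
      right_inv := (mul_nonsing_inv_cancel_left _ · hQt) }
  refine (Nat.card_congr (Equiv.subtypeEquiv (mulLeft.prodCongr (Equiv.refl _)) ?_)).symm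
  rintro ⟨C, E⟩
  have hmul : fromBlocks (Qᵀ * A * Q) (Qᵀ * C) (Qᵀ * C)ᵀ E =
      fromBlocks Qᵀ 0 0 1 * fromBlocks A C Cᵀ E * fromBlocks Q 0 0 1 := by
    simp [fromBlocks_multiply]
  have hdet : (fromBlocks (Qᵀ * A * Q) (Qᵀ * C) (Qᵀ * C)ᵀ E).det =
      Q.det * (fromBlocks A C Cᵀ E).det * Q.det := by
    rw [hmul, det_mul, det_mul, det_fromBlocks_zero₂₁, det_fromBlocks_zero₂₁, det_one, mul_one,
      mul_one, det_transpose]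
  change _ ↔ E.IsSymm ∧ (fromBlocks (Qᵀ * A * Q) (Qᵀ * C) (Qᵀ * C)ᵀ E).det ≠ 0
  rw [hdet]
  simp [hQ]

theorem borderCount_submatrix (A : Matrix ι ι K) (e : α ≃ ι) :
    borderCount (A.submatrix e e) κ = borderCount A κ := by
  refine (Nat.card_congr (Equiv.subtypeEquiv
    ((reindex e.symm (Equiv.refl κ)).prodCongr (Equiv.refl _)) ?_)).symm
  rintro ⟨C, E⟩
  have hsub : fromBlocks (A.submatrix e e) (C.submatrix e id) (C.submatrix e id)ᵀ E =
      (fromBlocks A C Cᵀ E).submatrix (e.sumCongr (Equiv.refl κ)) (e.sumCongr (Equiv.refl κ)) := by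
    ext (i | i) (j | j) <;> rfl
  change _ ↔ E.IsSymm ∧
    (fromBlocks (A.submatrix e e) (C.submatrix e id) (C.submatrix e id)ᵀ E).det ≠ 0
  rw [hsub, det_submatrix_equiv_self]

theorem det_fromBlocks_fromBlocks_zero {A : Matrix α α K} (hA : A.det ≠ 0) (C₁ : Matrix α κ K)
    (C₂ : Matrix β κ K) (E : Matrix κ κ K) :
    (fromBlocks (fromBlocks A 0 0 (0 : Matrix β β K)) (fromRows C₁ C₂) (fromRows C₁ C₂)ᵀ E).det =
      A.det * (fromBlocks 0 C₂ C₂ᵀ (E - C₁ᵀ * A⁻¹ * C₁)).det := by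
  have hassoc :
      fromBlocks (fromBlocks A 0 0 (0 : Matrix β β K)) (fromRows C₁ C₂) (fromRows C₁ C₂)ᵀ E =
        (fromBlocks A (fromCols 0 C₁) (fromRows 0 C₁ᵀ) (fromBlocks 0 C₂ C₂ᵀ E)).submatrix
          (Equiv.sumAssoc α β κ) (Equiv.sumAssoc α β κ) := by
    ext ((i | i) | i) ((j | j) | j) <;> rfl
  have := A.invertibleOfIsUnitDet (isUnit_iff_ne_zero.2 hA)
  rw [hassoc, det_submatrix_equiv_self, det_fromBlocks₁₁, invOf_eq_nonsing_inv, fromRows_mul,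
    fromRows_mul_fromCols]
  congr 2
  ext (i | i) (j | j) <;> simp

theorem borderCount_fromBlocks_zero {A : Matrix α α K} (hs : A.IsSymm) (hA : A.det ≠ 0) :
    borderCount (fromBlocks A 0 0 (0 : Matrix β β K)) κ =
      Nat.card K ^ (Fintype.card α * Fintype.card κ) * borderCount (0 : Matrix β β K) κ := by
  have hcard : Nat.card (Matrix α κ K) = Nat.card K ^ (Fintype.card α * Fintype.card κ) := by
    rw [Nat.card_congr (of.symm : Matrix α κ K ≃ (α → κ → K)), Nat.card_fun, Nat.card_fun,
      Nat.card_eq_fintype_card (α := α), Nat.card_eq_fintype_card (α := κ), ← pow_mul, mul_comm]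
  have hsymm (C : Matrix α κ K) : (Cᵀ * A⁻¹ * C).IsSymm := by
    rw [IsSymm, transpose_mul, transpose_mul, transpose_nonsing_inv, hs, transpose_transpose,
      Matrix.mul_assoc]
  rw [← hcard, borderCount, borderCount, ← Nat.card_prod]
  refine Nat.card_congr
    { toFun := fun p => (p.1.1.toRows₁, ⟨(p.1.1.toRows₂,
        p.1.2 - p.1.1.toRows₁ᵀ * A⁻¹ * p.1.1.toRows₁), p.2.1.sub (hsymm _), fun h0 => p.2.2 ?_⟩)
      invFun := fun p => ⟨(fromRows p.1 p.2.1.1, p.2.1.2 + p.1ᵀ * A⁻¹ * p.1),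
        p.2.2.1.add (hsymm _), ?_⟩
      left_inv := fun p => by ext <;> simp
      right_inv := fun p => by ext <;> simp }
  · have hdet := det_fromBlocks_fromBlocks_zero hA p.1.1.toRows₁ p.1.1.toRows₂ p.1.2
    rwa [fromRows_toRows, h0, mul_zero] at hdet
  · rw [det_fromBlocks_fromBlocks_zero hA, add_sub_cancel_right]
    exact mul_ne_zero hA p.2.2.2

/-- The number of nondegenerate symmetric matrices of size `k + c` that begin with a zero block of
size `k`. -/
def zeroBlockCount (k c : ℕ) (K : Type*) [Field K] : ℕ :=
  borderCount (0 : Matrix (Fin k) (Fin k) K) (Fin c)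

theorem borderCount_eq_card_pow_mul_zeroBlockCount {A : Matrix ι ι K} (hA : A.IsSymm) {k : ℕ}
    (hk : A.rank + k = Fintype.card ι) (c : ℕ) :
    borderCount A (Fin c) = Nat.card K ^ (A.rank * c) * zeroBlockCount k c K := by
  obtain ⟨Q, e, M, hQ, hM, hM', h⟩ := exists_transpose_mul_mul_eq_fromBlocks hA hk
  rw [← borderCount_transpose_mul_mul A hQ, ← borderCount_submatrix _ e, h,
    borderCount_fromBlocks_zero hM hM', Fintype.card_fin, Fintype.card_fin, zeroBlockCount]

theorem zeroBlockCount_of_lt {k c : ℕ} (h : c < k) : zeroBlockCount k c K = 0 := by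
  refine @Nat.card_of_isEmpty _ ⟨fun ⟨⟨C, E⟩, _, hdet⟩ => hdet ?_⟩
  obtain ⟨x, hx, hx0⟩ : ∃ x ∈ LinearMap.ker Cᵀ.mulVecLin, x ≠ 0 :=
    Submodule.exists_mem_ne_zero_of_ne_bot (LinearMap.ker_ne_bot_of_finrank_lt (by simpa using h))
  refine exists_mulVec_eq_zero_iff.1 ⟨Sum.elim x 0, fun h0 => hx0 ?_, ?_⟩
  · exact funext fun i => congrFun h0 (Sum.inl i)
  · rw [fromBlocks_mulVec, Sum.elim_comp_inl, Sum.elim_comp_inr, zero_mulVec, mulVec_zero,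
      show Cᵀ *ᵥ x = 0 from hx, mulVec_zero, add_zero, add_zero, Sum.elim_zero_zero]

theorem zeroBlockCount_self_ne_zero [Finite K] (c : ℕ) : zeroBlockCount c c K ≠ 0 := by
  let J : Matrix (Fin c ⊕ Fin c) (Fin c ⊕ Fin c) K := fromBlocks 0 1 (1 : Matrix _ _ K)ᵀ 0
  have hJ : J * J = 1 := by simp [J, fromBlocks_multiply]
  have hdet : J.det ≠ 0 := left_ne_zero_of_mul_eq_one (b := J.det) (by rw [← det_mul, hJ, det_one])
  exact Nat.card_ne_zero.2 ⟨⟨(1, 0), isSymm_zero, hdet⟩, inferInstance⟩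

end Border

section Support

theorem fromBlocks_toBlocks_of_isSymm {ι κ K : Type*} {M : Matrix (ι ⊕ κ) (ι ⊕ κ) K}
    (hM : M.IsSymm) :
    fromBlocks M.toBlocks₁₁ M.toBlocks₁₂ M.toBlocks₁₂ᵀ M.toBlocks₂₂ = M := by
  have : M.toBlocks₁₂ᵀ = M.toBlocks₂₁ := Matrix.ext fun i j => hM.apply _ _
  rw [this, fromBlocks_toBlocks]

/-- The join of `G` with the complete graph on `κ`, i.e. an iterated cone over `G`. -/
def cone {ι : Type} (G : SimpleGraph ι) (κ : Type) : SimpleGraph (ι ⊕ κ) :=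
  (Gᶜ ⊕g (⊥ : SimpleGraph κ))ᶜ

theorem forall_not_adj_cone {ι κ : Type} {G : SimpleGraph ι} {P : ι ⊕ κ → ι ⊕ κ → Prop} :
    (∀ x y, x ≠ y → ¬ (cone G κ).Adj x y → P x y) ↔
      ∀ i j, i ≠ j → ¬ G.Adj i j → P (Sum.inl i) (Sum.inl j) := by
  simp +contextual [cone]

/-- The symmetric matrices whose off-diagonal entries vanish outside the edges of `G`. -/
abbrev SupportedSymm {ι : Type} (G : SimpleGraph ι) (K : Type) [Field K] : Type :=
  {M : Matrix ι ι K // M.IsSymm ∧ ∀ i j, i ≠ j → ¬ G.Adj i j → M i j = 0}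

/-- The number of symmetric matrices of rank `r` whose off-diagonal entries vanish outside the
edges of `G`. -/
def rankCount {ι : Type} [Fintype ι] (G : SimpleGraph ι) (r : ℕ) (K : Type) [Field K] : ℕ :=
  Nat.card {A : SupportedSymm G K // A.1.rank = r}

theorem rankCount_of_card_lt {ι : Type} [Fintype ι] (G : SimpleGraph ι) {r : ℕ}
    (hr : Fintype.card ι < r) (K : Type) [Field K] : rankCount G r K = 0 :=
  @Nat.card_of_isEmpty _ ⟨fun A => (A.1.1.rank_le_card_width.trans_lt hr).ne A.2⟩

/-- The graph of the nonzero off-diagonal entries of a symmetric matrix. -/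
def supportGraph {ι K : Type*} [Zero K] (A : Matrix ι ι K) : SimpleGraph ι :=
  SimpleGraph.fromRel fun i j => A i j ≠ 0

theorem supportGraph_le_iff {ι K : Type*} [Zero K] {A : Matrix ι ι K} (hA : A.IsSymm)
    {G : SimpleGraph ι} :
    supportGraph A ≤ G ↔ ∀ i j, i ≠ j → ¬ G.Adj i j → A i j = 0 := by
  simp only [supportGraph, SimpleGraph.le_iff_adj, SimpleGraph.fromRel_adj, hA.apply, or_self,
    and_imp, not_imp_comm]

/-- The number of symmetric matrices of rank `r` whose off-diagonal entries are nonzero exactly at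
the edges of `G`. -/
def exactRankCount {ι : Type} [Fintype ι] (G : SimpleGraph ι) (r : ℕ) (K : Type) [Field K] : ℕ :=
  Nat.card {A : Matrix ι ι K // A.IsSymm ∧ A.rank = r ∧ supportGraph A = G}

theorem rankCount_eq_sum {ι : Type} [Fintype ι] {G : SimpleGraph ι} {s : Finset (SimpleGraph ι)}
    (hs : ∀ G', G' ∈ s ↔ G' ≤ G) (r : ℕ) (K : Type) [Field K] [Finite K] :
    rankCount G r K = ∑ G' ∈ s, exactRankCount G' r K := by
  rw [← Finset.sum_coe_sort]
  simp only [exactRankCount]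
  rw [← Nat.card_sigma]
  exact Nat.card_congr
    { toFun := fun A => ⟨⟨supportGraph A.1.1, (hs _).2 ((supportGraph_le_iff A.1.2.1).2 A.1.2.2)⟩,
        A.1.1, A.1.2.1, A.2, rfl⟩
      invFun := fun p => ⟨⟨p.2.1, p.2.2.1, (supportGraph_le_iff p.2.2.1).1
        (p.2.2.2.2.trans_le ((hs _).1 p.1.2))⟩, p.2.2.2.1⟩
      left_inv := fun A => rfl
      right_inv := by
        rintro ⟨⟨G', hG'⟩, A, hA, hr, hAG'⟩
        obtain rfl : supportGraph A = G' := hAG'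
        rfl }

variable {ι κ : Type} [Fintype ι] [DecidableEq ι] [Fintype κ] [DecidableEq κ]

/-- The analogue of `countZo` for a graph with an arbitrary finite type of vertices. -/
def nondegCount (G : SimpleGraph ι) (K : Type) [Field K] : ℕ :=
  Nat.card {M : Matrix ι ι K // M.IsSymm ∧ M.det ≠ 0 ∧ ∀ i j, i ≠ j → ¬ G.Adj i j → M i j = 0}

theorem nondegCount_comap (G : SimpleGraph ι) (e : κ ≃ ι) (K : Type) [Field K] :
    nondegCount (G.comap e) K = nondegCount G K := by
  refine (Nat.card_congr (Equiv.subtypeEquiv (reindex e.symm e.symm) fun M => ?_)).symm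
  rw [reindex_apply, Equiv.symm_symm, det_submatrix_equiv_self]
  refine and_congr ⟨fun h => h.submatrix e, fun h => ?_⟩ (and_congr_right fun _ =>
    ⟨fun h i j hij hG => h _ _ (e.injective.ne hij) hG, fun h i j hij hG => ?_⟩)
  · simpa using h.submatrix e.symm
  · simpa using h (e.symm i) (e.symm j) (e.symm.injective.ne hij) (by simpa using hG)

theorem nondegCount_cone (G : SimpleGraph ι) (K : Type) [Field K] [Finite K]
    [Fintype (SupportedSymm G K)] :
    nondegCount (cone G κ) K = ∑ A : SupportedSymm G K, borderCount A.1 κ := by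
  simp only [nondegCount, borderCount, forall_not_adj_cone]
  rw [← Nat.card_sigma]
  refine Nat.card_congr
    { toFun := fun M => ⟨⟨M.1.toBlocks₁₁, M.2.1.submatrix Sum.inl, M.2.2.2⟩,
        ⟨(M.1.toBlocks₁₂, M.1.toBlocks₂₂), M.2.1.submatrix Sum.inr, ?_⟩⟩
      invFun := fun p => ⟨fromBlocks p.1.1 p.2.1.1 p.2.1.1ᵀ p.2.1.2,
        isSymm_fromBlocks_iff.2 ⟨p.1.2.1, rfl, rfl, p.2.2.1⟩, p.2.2.2, p.1.2.2⟩
      left_inv := fun M => Subtype.ext (fromBlocks_toBlocks_of_isSymm M.2.1)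
      right_inv := fun p => rfl }
  rw [fromBlocks_toBlocks_of_isSymm M.2.1]
  exact M.2.2.1

theorem nondegCount_cone_eq_sum (G : SimpleGraph ι) (c : ℕ) (K : Type) [Field K] [Finite K] :
    nondegCount (cone G (Fin c)) K = ∑ p ∈ Finset.HasAntidiagonal.antidiagonal (Fintype.card ι),
      rankCount G p.1 K * (Nat.card K ^ (p.1 * c) * zeroBlockCount p.2 c K) := by
  classical
  have := Fintype.ofFinite (SupportedSymm G K)
  have hmaps : ∀ A ∈ (Finset.univ : Finset (SupportedSymm G K)),
      (A.1.rank, Fintype.card ι - A.1.rank) ∈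
        Finset.HasAntidiagonal.antidiagonal (Fintype.card ι) :=
    fun A _ =>
      Finset.HasAntidiagonal.mem_antidiagonal.2 (Nat.add_sub_cancel' A.1.rank_le_card_width)
  rw [nondegCount_cone, ← Finset.sum_fiberwise_of_maps_to hmaps]
  refine Finset.sum_congr rfl fun p hp => ?_
  rw [Finset.HasAntidiagonal.mem_antidiagonal] at hp
  have hfiber : ∀ A : SupportedSymm G K,
      (A.1.rank, Fintype.card ι - A.1.rank) = p ↔ A.1.rank = p.1 := fun A => by
    rw [Prod.ext_iff, and_iff_left_of_imp]
    lia
  simp only [hfiber]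
  rw [rankCount, Nat.card_eq_fintype_card, Fintype.card_subtype]
  refine Finset.sum_eq_card_nsmul fun A hA => ?_
  have hA : A.1.rank = p.1 := (Finset.mem_filter.1 hA).2
  rw [borderCount_eq_card_pow_mul_zeroBlockCount A.2.1 (hA ▸ hp), hA]

end Support

section DiagonalSupport

variable {ι : Type}

theorem card_subtype_ne_zero (K : Type) [Zero K] [Finite K] :
    Nat.card {x : K // x ≠ 0} = Nat.card K - 1 := by
  classical
  have := Fintype.ofFinite K
  rw [Nat.card_eq_fintype_card, Nat.card_eq_fintype_card, Fintype.card_subtype_compl,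
    Fintype.card_subtype_eq]

theorem card_forall_ne_zero_iff_mem [Finite ι] (S : Finset ι) (K : Type) [Zero K] [Finite K] :
    Nat.card {d : ι → K // ∀ i, d i ≠ 0 ↔ i ∈ S} = (Nat.card K - 1) ^ S.card := by
  classical
  have := Fintype.ofFinite ι
  have hcoord : ∀ i, Nat.card {x : K // x ≠ 0 ↔ i ∈ S} = if i ∈ S then Nat.card K - 1 else 1 := by
    intro i
    split_ifs with hi
    · simp only [hi, iff_true]
      exact card_subtype_ne_zero K
    · simp [hi]
  rw [Nat.card_congr (Equiv.subtypePiEquivPi (p := fun i (x : K) => x ≠ 0 ↔ i ∈ S)), Nat.card_pi]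
  simp only [hcoord, Finset.prod_ite_mem, Finset.univ_inter, Finset.prod_const]

theorem card_filter_card_ne_zero [Fintype ι] [DecidableEq ι] (r : ℕ) (K : Type) [Zero K]
    [Fintype K] [DecidableEq K] :
    (Finset.univ.filter fun d : ι → K => (Finset.univ.filter fun i => d i ≠ 0).card = r).card =
      (Fintype.card ι).choose r * (Nat.card K - 1) ^ r := by
  let supp (d : ι → K) : Finset ι := Finset.univ.filter fun i => d i ≠ 0
  rw [Finset.card_eq_sum_card_fiberwise (f := supp) (t := Finset.univ.powersetCard r)
      fun d hd => Finset.mem_powersetCard.2 ⟨Finset.subset_univ _, (Finset.mem_filter.1 hd).2⟩,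
    ← Finset.card_univ, ← Finset.card_powersetCard, ← smul_eq_mul]
  refine Finset.sum_eq_card_nsmul fun S hS => ?_
  obtain rfl := (Finset.mem_powersetCard.1 hS).2
  rw [← card_forall_ne_zero_iff_mem, Nat.card_eq_fintype_card, Fintype.card_subtype,
    Finset.filter_filter]
  refine congrArg _ (Finset.filter_congr fun d _ => ?_)
  rw [and_iff_right_of_imp (congrArg Finset.card)]
  simp only [supp, Finset.ext_iff, Finset.mem_filter, Finset.mem_univ, true_and]

theorem rankCount_bot [Fintype ι] (r : ℕ) (K : Type) [Field K] [Finite K] :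
    rankCount (⊥ : SimpleGraph ι) r K = (Fintype.card ι).choose r * (Nat.card K - 1) ^ r := by
  classical
  have := Fintype.ofFinite K
  let e : (ι → K) ≃ SupportedSymm (⊥ : SimpleGraph ι) K :=
    { toFun := fun d => ⟨diagonal d, isSymm_diagonal d, fun i j h _ => diagonal_apply_ne _ h⟩
      invFun := fun A => A.1.diag
      left_inv := fun d => diag_diagonal d
      right_inv := fun A =>
        Subtype.ext ((isDiag_iff_diagonal_diag A.1).1 fun i j h => A.2.2 i j h id) }
  have hrank : ∀ d, (e d).1.rank = (Finset.univ.filter fun i => d i ≠ 0).card := fun d => by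
    rw [← Fintype.card_subtype]
    exact rank_diagonal d
  rw [rankCount, ← Nat.card_congr (e.subtypeEquiv fun d => Iff.rfl), Nat.card_eq_fintype_card,
    Fintype.card_subtype]
  simp only [hrank]
  exact card_filter_card_ne_zero r K

end DiagonalSupport

section Generation

variable {ι : Type} [Fintype ι] {P : ((K : Type) → [Field K] → ℕ) → Prop}
  (hP : IsRationallyClosed P) (H : ∀ (n : ℕ) (G : SimpleGraph (Fin n)), P (countZo G))
include hP H

namespace IsRationallyClosed

theorem nondegCount_of_countZo [DecidableEq ι] (G : SimpleGraph ι) : P (nondegCount G) :=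
  hP.congr (H _ (G.comap (Fintype.equivFin ι).symm)) fun K _ _ =>
    (nondegCount_comap G (Fintype.equivFin ι).symm K).symm

theorem zeroBlockCount_of_countZo (k c : ℕ) : P (zeroBlockCount k c) := by
  induction k using Nat.strong_induction_on with
  | _ k ih =>
  have hsplit : ∀ (K : Type) [Field K] [Finite K],
      zeroBlockCount k c K +
        ∑ p ∈ (Finset.HasAntidiagonal.antidiagonal k).erase (0, k),
          rankCount (⊥ : SimpleGraph (Fin k)) p.1 K *
            (Nat.card K ^ (p.1 * c) * zeroBlockCount p.2 c K) =
        nondegCount (cone (⊥ : SimpleGraph (Fin k)) (Fin c)) K := fun K _ _ => by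
    rw [nondegCount_cone_eq_sum, Fintype.card_fin,
      ← Finset.add_sum_erase _ _ (a := (0, k))
        (Finset.HasAntidiagonal.mem_antidiagonal.2 (zero_add k)),
      rankCount_bot, Nat.choose_zero_right, pow_zero, zero_mul, pow_zero, one_mul, one_mul, one_mul]
  refine hP.of_add_right (hP.congr (hP.nondegCount_of_countZo H _) hsplit)
    (hP.sum _ fun p hp => ?_)
  obtain ⟨hne, hp⟩ := Finset.mem_erase.1 hp
  rw [Finset.HasAntidiagonal.mem_antidiagonal] at hp
  have hlt : p.2 < k := by
    contrapose! hne
    exact Prod.ext (by lia) (by lia)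
  refine hP.mul ?_ (hP.mul (hP.pow hP.card _) (ih p.2 hlt))
  exact hP.congr (hP.mul (hP.const _) (hP.pow hP.card_sub_one _)) fun K _ _ => rankCount_bot p.1 K

theorem rankCount_of_countZo (G : SimpleGraph ι) (r : ℕ) : P (rankCount G r) := by
  classical
  obtain hr | hr := lt_or_ge (Fintype.card ι) r
  · exact hP.congr (hP.const 0) fun K _ _ => rankCount_of_card_lt G hr K
  obtain ⟨c, hc⟩ := Nat.exists_eq_add_of_le hr
  clear hr
  induction c using Nat.strong_induction_on generalizing r with
  | _ c ih =>
  have hsplit : ∀ (K : Type) [Field K] [Finite K],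
      rankCount G r K * (Nat.card K ^ (r * c) * zeroBlockCount c c K) +
        ∑ p ∈ (Finset.HasAntidiagonal.antidiagonal (Fintype.card ι)).erase (r, c),
          rankCount G p.1 K * (Nat.card K ^ (p.1 * c) * zeroBlockCount p.2 c K) =
        nondegCount (cone G (Fin c)) K := fun K _ _ => by
    rw [nondegCount_cone_eq_sum,
      ← Finset.add_sum_erase _ _ (a := (r, c))
        (Finset.HasAntidiagonal.mem_antidiagonal.2 hc.symm)]
  have hcoeff (j k : ℕ) := hP.mul (hP.pow hP.card j) (hP.zeroBlockCount_of_countZo H k c)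
  have hsum := hP.of_add_right (hP.congr (hP.nondegCount_of_countZo H _) hsplit)
    (hP.sum _ fun p hp => ?_)
  · exact hP.of_mul_right hsum (hcoeff _ c) fun K _ _ =>
      mul_ne_zero (pow_ne_zero _ Finite.card_pos.ne') (zeroBlockCount_self_ne_zero c)
  obtain ⟨hne, hp⟩ := Finset.mem_erase.1 hp
  rw [Finset.HasAntidiagonal.mem_antidiagonal] at hp
  obtain hlt | hlt | heq := lt_trichotomy c p.2
  · exact hP.congr (hP.const 0) fun K _ _ => by
      rw [zeroBlockCount_of_lt hlt, mul_zero, mul_zero]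
  · exact absurd (Prod.ext (by lia) hlt.symm) hne
  · exact hP.mul (ih p.2 heq p.1 hp.symm) (hcoeff _ p.2)

theorem exactRankCount_of_countZo (G : SimpleGraph ι) (r : ℕ) : P (exactRankCount G r) := by
  classical
  have := Fintype.ofFinite (SimpleGraph ι)
  induction G using WellFoundedLT.induction with
  | _ G ih =>
  let s := Finset.univ.filter fun G' => G' ≤ G
  have hs : ∀ G', G' ∈ s ↔ G' ≤ G := fun G' => by simp [s]
  refine hP.of_add_right (hP.congr (hP.rankCount_of_countZo H G r) fun K _ _ => ?_)
    (hP.sum (s.erase G) fun G' hG' => ih G' ?_)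
  · rw [rankCount_eq_sum hs, ← Finset.add_sum_erase s _ ((hs G).2 le_rfl)]
  · obtain ⟨hne, hG'⟩ := Finset.mem_erase.1 hG'
    exact ((hs G').1 hG').lt_of_ne hne

end IsRationallyClosed

end Generation

section RankTwo

variable {K ι : Type*} [Field K] [Fintype ι] {A : Matrix ι ι K}

theorem det_submatrix_eq_zero_of_rank_lt {n : ℕ} (h : A.rank < n) (r s : Fin n → ι) :
    (A.submatrix r s).det = 0 := by
  by_contra hdet
  have hrank := rank_of_isUnit _ ((isUnit_iff_isUnit_det _).2 (isUnit_iff_ne_zero.2 hdet))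
  rw [Fintype.card_fin] at hrank
  exact ((A.rank_submatrix_le r s).trans_lt h).ne hrank

theorem apply_self_eq_zero_of_rank_lt_three (hA : A.rank < 3) {i j k l m : ι} (hik : A i k = 0)
    (hji : A j i = 0) (hjk : A j k = 0) (hjm : A j m ≠ 0) (hlk : A l k ≠ 0) : A i i = 0 := by
  have hdet := det_submatrix_eq_zero_of_rank_lt hA ![i, j, l] ![i, k, m]
  rw [det_fin_three] at hdet
  simpa [hik, hji, hjk, hjm, hlk] using hdet

theorem two_eq_zero_of_rank_lt_three (hs : A.IsSymm) (hA : A.rank < 3) {i j k : ι}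
    (hi : A i i = 0) (hj : A j j = 0) (hk : A k k = 0) (hij : A i j ≠ 0) (hik : A i k ≠ 0)
    (hjk : A j k ≠ 0) : (2 : K) = 0 := by
  have hdet := det_submatrix_eq_zero_of_rank_lt hA ![i, j, k] ![i, j, k]
  simp only [det_fin_three, submatrix_apply, cons_val, hi, hj, hk, hs.apply i j, hs.apply i k,
    hs.apply j k] at hdet
  have : 2 * (A i j * A i k * A j k) = 0 := by linear_combination hdet
  exact (mul_eq_zero.1 this).resolve_right (mul_ne_zero (mul_ne_zero hij hik) hjk)

end RankTwo

section Equipartite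

variable {K : Type} [Field K]

theorem two_eq_zero_of_supportGraph_eq {A : Matrix (Fin 3 × Fin 3) (Fin 3 × Fin 3) K}
    (hs : A.IsSymm) (hr : A.rank < 3)
    (hA : supportGraph A = SimpleGraph.completeEquipartiteGraph 3 3) : (2 : K) = 0 := by
  have hsupp : ∀ x y, x ≠ y → (A x y ≠ 0 ↔ x.1 ≠ y.1) := fun x y hxy => by
    rw [← SimpleGraph.completeEquipartiteGraph_adj, ← hA, supportGraph, SimpleGraph.fromRel_adj,
      hs.apply, or_self, and_iff_right hxy]
  have hzero : ∀ a i j, i ≠ j → A (a, i) (a, j) = 0 := fun a i j hij =>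
    not_not.1 fun h => (hsupp (a, i) (a, j) (by simpa using hij)).1 h rfl
  have hne : ∀ a b i j, a ≠ b → A (a, i) (b, j) ≠ 0 := fun a b i j hab =>
    (hsupp (a, i) (b, j) (by simp [hab])).2 hab
  have hdiag : ∀ a, A (a, 0) (a, 0) = 0 := fun a => by
    have hab : a ≠ a + 1 := by simp
    exact apply_self_eq_zero_of_rank_lt_three hr (hzero a 0 2 (by decide)) (hzero a 1 0 (by decide))
      (hzero a 1 2 (by decide)) (hne a (a + 1) 1 0 hab) (hne (a + 1) a 0 2 hab.symm)
  exact two_eq_zero_of_rank_lt_three hs hr (hdiag 0) (hdiag 1) (hdiag 2)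
    (hne 0 1 0 0 (by decide)) (hne 0 2 0 0 (by decide)) (hne 1 2 0 0 (by decide))

variable (K) in
/-- The adjacency matrix of `K_{3,3,3}`. -/
def equipartiteMatrix : Matrix (Fin 3 × Fin 3) (Fin 3 × Fin 3) K :=
  of fun x y => if x.1 = y.1 then 0 else 1

variable (K) in
theorem rank_equipartiteMatrix [CharP K 2] : (equipartiteMatrix K).rank = 2 := by
  refine le_antisymm ?_ (not_lt.1 fun h => ?_)
  -- In characteristic two, `x₁y₂ + x₂y₁` is alternating, and it is `1` on any two of these vectors.
  · let u : Fin 3 → Fin 2 → K := ![![1, 0], ![0, 1], ![1, 1]]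
    have hmul : equipartiteMatrix K = (of fun (x : Fin 3 × Fin 3) i => u x.1 i) *
        (of fun i (y : Fin 3 × Fin 3) => u y.1 (Equiv.swap 0 1 i)) := by
      ext ⟨a, i⟩ ⟨b, j⟩
      fin_cases a <;> fin_cases b <;>
        simp [equipartiteMatrix, mul_apply, u, CharTwo.add_self_eq_zero]
    rw [hmul]
    exact (rank_mul_le_left _ _).trans (rank_le_card_width _)
  · have hdet := det_submatrix_eq_zero_of_rank_lt h ![(0, 0), (1, 0)] ![(0, 0), (1, 0)]
    rw [det_fin_two] at hdet
    simp [equipartiteMatrix] at hdet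

theorem exactRankCount_completeEquipartiteGraph_ne_zero_iff (K : Type) [Field K] [Finite K] :
    exactRankCount (SimpleGraph.completeEquipartiteGraph 3 3) 2 K ≠ 0 ↔ CharP K 2 := by
  refine Nat.card_ne_zero.trans ⟨?_, fun hK => ⟨⟨equipartiteMatrix K, ?_,
    rank_equipartiteMatrix K, ?_⟩, inferInstance⟩⟩
  · rintro ⟨⟨A, hs, hr, hA⟩, -⟩
    exact CharTwo.of_one_ne_zero_of_two_eq_zero one_ne_zero
      (two_eq_zero_of_supportGraph_eq hs (by lia) hA)
  · exact IsSymm.ext fun x y => by simp [equipartiteMatrix, eq_comm]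
  · ext x y
    simp only [supportGraph, SimpleGraph.fromRel_adj, equipartiteMatrix, of_apply,
      SimpleGraph.completeEquipartiteGraph_adj, ite_ne_left_iff]
    grind

theorem not_forall_isRational_countZo :
    ¬ ∀ (n : ℕ) (G : SimpleGraph (Fin n)), IsRational (countZo G) := fun H =>
  not_isRational_of_ne_zero_iff_charP 2 exactRankCount_completeEquipartiteGraph_ne_zero_iff
    (isRationallyClosed_isRational.exactRankCount_of_countZo H _ 2)

end Equipartite

section Ends

theorem subsingleton_quot_iff {α : Type*} {r : α → α → Prop} :
    Subsingleton (Quot r) ↔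
      ∀ f : α → Prop, (∀ x y, r x y → (f x ↔ f y)) → ∀ x y, f x ↔ f y := by
  refine ⟨fun h f hf x y => ?_, fun h => ⟨Quot.ind fun x => Quot.ind fun y => ?_⟩⟩
  · exact iff_of_eq (congrArg (Quot.lift f fun a b hab => propext (hf a b hab))
      (Subsingleton.elim (Quot.mk r x) (Quot.mk r y)))
  · exact (h (fun z => Quot.mk r x = Quot.mk r z)
      (fun a b hab => by rw [Quot.sound hab]) x y).1 rfl

variable {V E : Type}

/-- The graph with vertices `V` and edges `E`, where the edge `e` has the ends `s e` and `t e`. -/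
def graphOfEnds (s t : E → V) : Graph V E where
  vertexSet := Set.univ
  edgeSet := Set.univ
  IsLink e x y := (s e = x ∧ t e = y) ∨ (s e = y ∧ t e = x)
  isLink_symm _ _ := ⟨fun _ _ h => h.symm⟩
  eq_or_eq_of_isLink_of_isLink := by
    rintro e x y v w (⟨rfl, rfl⟩ | ⟨rfl, rfl⟩) (⟨rfl, rfl⟩ | ⟨rfl, rfl⟩) <;> simp
  edge_mem_iff_exists_isLink e := by simpa using ⟨s e, t e, Or.inl ⟨rfl, rfl⟩⟩
  left_mem_of_isLink := by simp

/-- The edges in `T` connect all vertices. This is encoded by the absence of nontrivial vertex sets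
that no edge in `T` leaves, which avoids paths. -/
def Connects (s t : E → V) (T : Finset E) : Prop :=
  ∀ f : V → Prop, (∀ e ∈ T, f (s e) ↔ f (t e)) → ∀ x y, f x ↔ f y

/-- The edges in `T` form a spanning tree: they connect all vertices, and there is one edge less
than there are vertices. -/
def IsTreeSet [Fintype V] (s t : E → V) (T : Finset E) : Prop :=
  T.card + 1 = Fintype.card V ∧ Connects s t T

theorem bettiZero_restrict_eq_one_iff (s t : E → V) [Nonempty V] (T : Finset E) :
    bettiZero ((graphOfEnds s t).restrict (T : Set E)) = 1 ↔ Connects s t T := by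
  let G := (graphOfEnds s t).restrict (T : Set E)
  have hadj {x y} : G.Adj x y ↔ ∃ e ∈ T, (s e = x ∧ t e = y) ∨ (s e = y ∧ t e = x) := Iff.rfl
  have hinv (f : V → Prop) :
      (∀ x y, G.Adj x y → (f x ↔ f y)) ↔ ∀ e ∈ T, f (s e) ↔ f (t e) := by
    refine ⟨fun h e he => h _ _ (hadj.2 ⟨e, he, .inl ⟨rfl, rfl⟩⟩), fun h x y hxy => ?_⟩
    obtain ⟨e, he, ⟨rfl, rfl⟩ | ⟨rfl, rfl⟩⟩ := hadj.1 hxy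
    exacts [h e he, (h e he).symm]
  let φ : G.vertexSet ≃ V := Equiv.Set.univ V
  have : Nonempty G.vertexSet := φ.nonempty
  change Nat.card (Quot fun x y : G.vertexSet => G.Adj x y) = 1 ↔ _
  rw [Nat.card_eq_one_iff_unique, and_iff_left (Nonempty.map (Quot.mk _) this),
    subsingleton_quot_iff, Connects, (φ.arrowCongr (Equiv.refl Prop)).forall_congr_left]
  refine forall_congr' fun f => imp_congr (Iff.trans ?_ (hinv f)) ?_
  · exact ⟨fun h x y => h ⟨x, trivial⟩ ⟨y, trivial⟩, fun h x y => h x.1 y.1⟩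
  · exact ⟨fun h x y => h ⟨x, trivial⟩ ⟨y, trivial⟩, fun h x y => h x.1 y.1⟩

theorem isTree_restrict_iff [Fintype V] (s t : E → V) (T : Finset E) :
    IsTree ((graphOfEnds s t).restrict (T : Set E)) ↔ IsTreeSet s t T := by
  obtain hV | hV := isEmpty_or_nonempty V
  · have : IsEmpty ((graphOfEnds s t).restrict (T : Set E)).vertexSet := ⟨fun x => hV.elim x.1⟩
    simp [IsTree, IsTreeSet, bettiZero]
  · have hv : ((graphOfEnds s t).restrict (T : Set E)).vertexSet.ncard = Fintype.card V := by
      rw [← Nat.card_eq_fintype_card, ← Set.ncard_univ]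
      rfl
    have he : ((graphOfEnds s t).restrict (T : Set E)).edgeSet.ncard = T.card := by
      rw [← Set.ncard_coe_finset]
      exact congrArg Set.ncard (Set.univ_inter (T : Set E))
    rw [IsTree, IsTreeSet, ← bettiZero_restrict_eq_one_iff, bettiOne, hv, he, and_comm]
    exact and_congr_left fun h => by lia

theorem isSpanningTree_iff [Fintype V] (s t : E → V) (T : Finset (graphOfEnds s t).edgeSet) :
    IsSpanningTree (graphOfEnds s t) T ↔
      IsTreeSet s t (T.map (Function.Embedding.subtype _)) := by
  rw [← isTree_restrict_iff, IsSpanningTree, Finset.coe_map]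
  rfl

variable [Fintype V] [Fintype E] {R : Type*}

open Classical in
/-- The value at `x` of the sum of the monomials `∏_{e ∈ T} x_e`, over all spanning trees `T`. -/
def treeSum [CommSemiring R] (s t : E → V) (x : E → R) : R :=
  ∑ T : Finset E with IsTreeSet s t T, ∏ e ∈ T, x e

open Classical in
/-- The value at `x` of the sum of the monomials `∏_{e ∉ T} x_e`, over all spanning trees `T`. -/
def cotreeSum [CommSemiring R] (s t : E → V) (x : E → R) : R :=
  ∑ T : Finset E with IsTreeSet s t T, ∏ e ∈ Tᶜ, x e

open Classical in
theorem sum_isSpanningTree [AddCommMonoid R] (s t : E → V) [Fintype (graphOfEnds s t).edgeSet]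
    (f : Finset E → R) :
    ∑ T : Finset (graphOfEnds s t).edgeSet with IsSpanningTree (graphOfEnds s t) T,
      f (T.map (Function.Embedding.subtype _)) = ∑ T : Finset E with IsTreeSet s t T, f T := by
  simp only [Finset.sum_filter, isSpanningTree_iff]
  let ε : (graphOfEnds s t).edgeSet ≃ E := Equiv.Set.univ E
  exact Fintype.sum_equiv ε.finsetCongr _
    (fun T => if IsTreeSet s t T then f T else 0) fun T => rfl

theorem aeval_polyQ_graphOfEnds [CommRing R] (s t : E → V) [Fintype (graphOfEnds s t).edgeSet]
    (x : E → R) :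
    MvPolynomial.aeval (fun e : (graphOfEnds s t).edgeSet => x e) (polyQ (graphOfEnds s t)) =
      treeSum s t x := by
  classical
  rw [polyQ, map_sum, treeSum, ← sum_isSpanningTree]
  refine Finset.sum_congr rfl fun T _ => ?_
  rw [map_prod, Finset.prod_map]
  simp only [MvPolynomial.aeval_X, Function.Embedding.subtype_apply]

theorem aeval_polyP_graphOfEnds [CommRing R] (s t : E → V) [Fintype (graphOfEnds s t).edgeSet]
    (x : E → R) :
    MvPolynomial.aeval (fun e : (graphOfEnds s t).edgeSet => x e) (polyP (graphOfEnds s t)) =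
      cotreeSum s t x := by
  classical
  rw [polyP, map_sum, cotreeSum, ← sum_isSpanningTree]
  refine Finset.sum_congr rfl fun T _ => ?_
  have hcompl : (T.map (Function.Embedding.subtype _))ᶜ =
      Tᶜ.map (Function.Embedding.subtype _) := by
    ext e
    simp [show e ∈ (graphOfEnds s t).edgeSet from trivial]
  rw [map_prod, hcompl, Finset.prod_map]
  simp only [MvPolynomial.aeval_X, Function.Embedding.subtype_apply]

theorem countX_graphOfEnds (s t : E → V) [Fintype (graphOfEnds s t).edgeSet] (K : Type) [Field K] :
    countX (graphOfEnds s t) K = Nat.card {x : E → K // treeSum s t x ≠ 0} :=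
  (Nat.card_congr (((Equiv.Set.univ E).arrowCongr (Equiv.refl K)).symm.subtypeEquiv fun x =>
    not_congr (Eq.congr_left (aeval_polyQ_graphOfEnds s t x).symm))).symm

theorem countY_graphOfEnds (s t : E → V) [Fintype (graphOfEnds s t).edgeSet] (K : Type) [Field K] :
    countY (graphOfEnds s t) K = Nat.card {x : E → K // cotreeSum s t x ≠ 0} :=
  (Nat.card_congr (((Equiv.Set.univ E).arrowCongr (Equiv.refl K)).symm.subtypeEquiv fun x =>
    not_congr (Eq.congr_left (aeval_polyP_graphOfEnds s t x).symm))).symm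

end Ends

section CauchyBinet

variable {ι E R : Type*} [Fintype ι]

theorem sum_filter_image_eq_sum_perm [Fintype E] [DecidableEq ι] [DecidableEq E]
    [AddCommMonoid R] {T : Finset E} (σ : ι ≃ T) (F : (ι → E) → R) :
    ∑ f : ι → E with Finset.univ.image f = T, F f =
      ∑ π : Equiv.Perm ι, F fun i => σ (π i) := by
  refine (Finset.sum_bij (fun π _ i => (σ (π i) : E)) (fun π _ => ?_) (fun π _ π' _ h => ?_)
    (fun f hf => ?_) (fun _ _ => rfl)).symm
  · rw [Finset.mem_filter_univ]
    ext e
    simp only [Finset.mem_image, Finset.mem_univ, true_and]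
    exact ⟨fun ⟨i, hi⟩ => hi ▸ (σ (π i)).2, fun he => ⟨π.symm (σ.symm ⟨e, he⟩), by simp⟩⟩
  · exact Equiv.ext fun i => σ.injective (Subtype.ext (congrFun h i))
  · obtain rfl := (Finset.mem_filter.1 hf).2
    let φ (i : ι) : ι := σ.symm ⟨f i, Finset.mem_image_of_mem f (Finset.mem_univ i)⟩
    have hφ : Function.Surjective φ := fun j => by
      obtain ⟨i, -, hi⟩ := Finset.mem_image.1 (σ j).2
      exact ⟨i, by simp [φ, hi]⟩
    exact ⟨Equiv.ofBijective φ (Finite.surjective_iff_bijective.1 hφ), Finset.mem_univ _,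
      funext fun i => by simp [φ]⟩

variable [DecidableEq ι] [CommRing R]

theorem det_mul_eq_sum [Fintype E] (M : Matrix ι E R) (N : Matrix E ι R) :
    (M * N).det = ∑ f : ι → E, (∏ i, M i (f i)) * (N.submatrix f id).det := by
  have hrow : M * N = fun i => ∑ e, M i e • N e := by
    ext i j
    simp [Matrix.mul_apply]
  rw [hrow]
  change (detRowAlternating : (ι → R) [⋀^ι]→ₗ[R] R).toMultilinearMap _ = _
  rw [MultilinearMap.map_sum]
  refine Finset.sum_congr rfl fun f _ => ?_
  rw [MultilinearMap.map_smul_univ, smul_eq_mul]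
  rfl

theorem sum_perm_prod_mul_det_submatrix (M : Matrix ι E R) (N : Matrix E ι R) (f : ι → E) :
    ∑ π : Equiv.Perm ι, (∏ i, M i (f (π i))) * (N.submatrix (fun i => f (π i)) id).det =
      (M.submatrix id f).det * (N.submatrix f id).det := by
  rw [← det_transpose (M.submatrix id f), det_apply', Finset.sum_mul]
  refine Finset.sum_congr rfl fun π _ => ?_
  have hperm : (N.submatrix (fun i => f (π i)) id).det =
      Equiv.Perm.sign π * (N.submatrix f id).det := det_permute π (N.submatrix f id)
  rw [hperm]
  simp only [transpose_apply, submatrix_apply, id]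
  ring

/-- The Cauchy–Binet formula. The enumerations `σ` of the sets `T` are quantified over instead of
chosen: `g T` is the product of the two minors for any of them. -/
theorem det_mul_eq_sum_powersetCard [Fintype E] (M : Matrix ι E R) (N : Matrix E ι R)
    {g : Finset E → R} (hg : ∀ (T : Finset E) (σ : ι ≃ T),
      (M.submatrix id fun i => (σ i : E)).det * (N.submatrix (fun i => (σ i : E)) id).det = g T) :
    (M * N).det = ∑ T ∈ Finset.univ.powersetCard (Fintype.card ι), g T := by
  classical
  rw [det_mul_eq_sum, ← Finset.sum_fiberwise Finset.univ (fun f : ι → E => Finset.univ.image f)]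
  refine (Finset.sum_subset (Finset.subset_univ _) fun T _ hT => ?_).symm.trans
    (Finset.sum_congr rfl fun T hT => ?_)
  · refine Finset.sum_eq_zero fun f hf => ?_
    obtain rfl := (Finset.mem_filter.1 hf).2
    have hinj : ¬ Function.Injective f := fun h => hT (Finset.mem_powersetCard_univ.2
      (by rw [Finset.card_image_of_injective _ h, Finset.card_univ]))
    obtain ⟨i, j, hij, hne⟩ := Function.not_injective_iff.1 hinj
    rw [det_zero_of_row_eq hne (by ext k; simp [hij]), mul_zero]
  · let σ : ι ≃ T := Fintype.equivOfCardEq (by simp [(Finset.mem_powersetCard.1 hT).2])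
    rw [sum_filter_image_eq_sum_perm σ, ← hg T σ]
    exact sum_perm_prod_mul_det_submatrix M N fun i => σ i

end CauchyBinet

section MatrixTree

variable {ι E : Type} {R : Type*} [DecidableEq ι]

variable (R) in
/-- The incidence matrix of the graph with the vertices `Option ι`, oriented from `t e` to `s e`.
The row of the vertex `none` is omitted. -/
def incidence [Ring R] (s t : E → Option ι) : Matrix ι E R :=
  of fun i e => (if s e = some i then 1 else 0) - (if t e = some i then 1 else 0)

theorem map_incidence [Ring R] {S : Type*} [Ring S] (φ : R →+* S) (s t : E → Option ι) :
    (incidence R s t).map φ = incidence S s t := by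
  ext i e
  simp only [incidence, map_apply, of_apply, map_sub, apply_ite φ, map_one, map_zero]

variable [Fintype ι]

theorem vecMul_incidence [CommRing R] (s t : E → Option ι) (g : ι → R) (e : E) :
    (g ᵥ* incidence R s t) e = (s e).elim 0 g - (t e).elim 0 g := by
  have h : ∀ v : Option ι, ∑ i, g i * (if v = some i then 1 else 0) = v.elim 0 g := by
    rintro (_ | v) <;> simp
  simp only [vecMul, dotProduct, incidence, of_apply, mul_sub, Finset.sum_sub_distrib, h]

theorem det_incidence_ne_zero_iff (F : Type*) [Field F] (s t : E → Option ι) {T : Finset E}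
    (σ : ι ≃ T) :
    ((incidence F s t).submatrix id fun i => (σ i : E)).det ≠ 0 ↔ Connects s t T := by
  have hvec (g : ι → F) : g ᵥ* (incidence F s t).submatrix id (fun i => (σ i : E)) = 0 ↔
      ∀ e ∈ T, (s e).elim 0 g = (t e).elim 0 g := by
    have hi (i : ι) : (g ᵥ* (incidence F s t).submatrix id (fun i => (σ i : E))) i =
        (s (σ i)).elim 0 g - (t (σ i)).elim 0 g := vecMul_incidence s t g (σ i)
    simp only [funext_iff, hi, Pi.zero_apply, sub_eq_zero]
    rw [σ.forall_congr_left, Subtype.forall]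
    simp
  constructor
  · intro hdet f hf
    classical
    let g : ι → F := fun i => if f (some i) ↔ f none then 0 else 1
    have hg : ∀ v : Option ι, v.elim 0 g = if f v ↔ f none then 0 else 1 := by
      rintro (_ | v) <;> simp [g]
    have hg0 : g = 0 :=
      eq_zero_of_vecMul_eq_zero hdet ((hvec g).2 fun e he => by rw [hg, hg, hf e he])
    have hnone : ∀ v, f v ↔ f none := fun v => by
      have := hg v
      rw [hg0] at this
      by_contra hv
      rw [if_neg hv] at this
      cases v <;> simp at this
    exact fun x y => (hnone x).trans (hnone y).symm
  · intro hT hdet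
    obtain ⟨g, hg, hg0⟩ := exists_vecMul_eq_zero_iff.2 hdet
    refine hg (funext fun i => ?_)
    exact (hT (fun v => v.elim 0 g = 0) (fun e he => by rw [(hvec g).1 hg0 e he])
      none (some i)).1 rfl

theorem intCast_det_incidence [CommRing R] (s t : E → Option ι) (f : ι → E) :
    (((incidence ℤ s t).submatrix id f).det : R) = ((incidence R s t).submatrix id f).det := by
  rw [← eq_intCast (Int.castRingHom R), RingHom.map_det, RingHom.mapMatrix_apply,
    ← submatrix_map, map_incidence]

theorem det_incidence_sq [CommRing R] (s t : E → Option ι) {T : Finset E} (σ : ι ≃ T)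
    [Decidable (Connects s t T)] :
    ((incidence R s t).submatrix id fun i => (σ i : E)).det ^ 2 =
      if Connects s t T then 1 else 0 := by
  rw [← intCast_det_incidence]
  set D : ℤ := ((incidence ℤ s t).submatrix id fun i => (σ i : E)).det with hD
  split_ifs with hT
  -- The integer `D` is nonzero modulo every prime.
  · have hunit : D.natAbs = 1 := by
      by_contra hne
      obtain ⟨p, hp, hdvd⟩ := Nat.exists_prime_and_dvd hne
      have := Fact.mk hp
      refine (det_incidence_ne_zero_iff (ZMod p) s t σ).2 hT ?_
      rw [← intCast_det_incidence, ZMod.intCast_zmod_eq_zero_iff_dvd]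
      exact Int.natCast_dvd.2 hdvd
    have hsq : D ^ 2 = 1 := by rw [← Int.natAbs_sq, hunit]; rfl
    exact_mod_cast congrArg (Int.cast : ℤ → R) hsq
  · have hzero : (D : ℚ) = 0 := by
      by_contra hne
      rw [hD, intCast_det_incidence] at hne
      exact hT ((det_incidence_ne_zero_iff ℚ s t σ).1 hne)
    rw [Int.cast_eq_zero.1 hzero, Int.cast_zero, zero_pow two_ne_zero]

theorem det_laplacian [Fintype E] [DecidableEq E] [CommRing R] (s t : E → Option ι) (x : E → R) :
    (incidence R s t * diagonal x * (incidence R s t)ᵀ).det = treeSum s t x := by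
  classical
  have hminor (T : Finset E) (σ : ι ≃ T) :
      ((incidence R s t * diagonal x).submatrix id fun i => (σ i : E)).det *
        ((incidence R s t)ᵀ.submatrix (fun i => (σ i : E)) id).det =
      if Connects s t T then ∏ e ∈ T, x e else 0 := by
    have hdiag : (incidence R s t * diagonal x).submatrix id (fun i => (σ i : E)) =
        (incidence R s t).submatrix id (fun i => (σ i : E)) * diagonal fun i => x (σ i) := by
      ext i j
      simp only [submatrix_apply, mul_diagonal, id]
    rw [hdiag, ← transpose_submatrix, det_transpose, det_mul, det_diagonal, mul_right_comm, ← sq,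
      det_incidence_sq, σ.prod_comp fun e : T => x e, Finset.prod_coe_sort]
    split_ifs <;> simp
  rw [det_mul_eq_sum_powersetCard _ _ hminor, treeSum, ← Finset.sum_filter]
  congr 1
  ext T
  simp [IsTreeSet]

end MatrixTree

section Apex

theorem eq_of_isSymm_of_lt_of_sum_eq {ι A : Type*} [Fintype ι] [LinearOrder ι]
    [AddCancelCommMonoid A] {M N : Matrix ι ι A} (hM : M.IsSymm) (hN : N.IsSymm)
    (hlt : ∀ i j, i < j → M i j = N i j) (hsum : ∀ i, ∑ j, M i j = ∑ j, N i j) : M = N := by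
  have hne (i j : ι) (hij : j ≠ i) : M i j = N i j := by
    obtain h | h := lt_or_gt_of_ne hij
    · rw [← hM.apply, ← hN.apply, hlt j i h]
    · exact hlt i j h
  ext i j
  obtain rfl | hij := eq_or_ne j i
  · have h := hsum j
    rw [← Finset.add_sum_erase _ _ (Finset.mem_univ j),
      ← Finset.add_sum_erase _ (N j) (Finset.mem_univ j),
      Finset.sum_congr rfl fun k hk => hne j k (Finset.ne_of_mem_erase hk)] at h
    exact add_right_cancel h
  · exact hne i j hij

variable {ι : Type} [LinearOrder ι] (G : SimpleGraph ι)

/-- The edges of the join of `G` with a vertex: an edge to the new vertex for each vertex of `G`,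
and the edges of `G`, which are represented by increasing pairs. -/
abbrev ApexEdge : Type := ι ⊕ {p : ι × ι // p.1 < p.2 ∧ G.Adj p.1 p.2}

/-- The first end of an edge of the join of `G` with the vertex `none`. -/
def apexSource : ApexEdge G → Option ι :=
  Sum.elim some fun p => some p.1.1

/-- The second end of an edge of the join of `G` with the vertex `none`. -/
def apexTarget : ApexEdge G → Option ι :=
  Sum.elim (fun _ => none) fun p => some p.1.2

variable [Fintype ι] [Fintype {p : ι × ι // p.1 < p.2 ∧ G.Adj p.1 p.2}] {R : Type*} [CommRing R]

/-- The weighted Laplacian of the join of `G` with a vertex, without the row and the column of this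
vertex. -/
def apexLaplacian (x : ApexEdge G → R) : Matrix ι ι R :=
  incidence R (apexSource G) (apexTarget G) * diagonal x *
    (incidence R (apexSource G) (apexTarget G))ᵀ

variable {G}

theorem isSymm_apexLaplacian (x : ApexEdge G → R) : (apexLaplacian G x).IsSymm := by
  rw [apexLaplacian, IsSymm, transpose_mul, transpose_mul, transpose_transpose,
    diagonal_transpose, Matrix.mul_assoc]

theorem sum_apexLaplacian (x : ApexEdge G → R) (i : ι) :
    ∑ j, apexLaplacian G x i j = x (Sum.inl i) := by
  have hone : (1 : ι → R) ᵥ* incidence R (apexSource G) (apexTarget G) =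
      Sum.elim (fun _ => 1) (fun _ => 0) := by
    ext (k | p) <;> rw [vecMul_incidence] <;> simp [apexSource, apexTarget]
  have hmul : ∑ j, apexLaplacian G x i j = (apexLaplacian G x *ᵥ 1) i := by
    simp [mulVec, dotProduct]
  rw [hmul, apexLaplacian, ← mulVec_mulVec, mulVec_transpose, hone]
  simp only [mulVec, dotProduct, mul_diagonal, Fintype.sum_sum_type, Sum.elim_inl, Sum.elim_inr]
  simp [incidence, apexSource, apexTarget]

theorem apexLaplacian_apply_of_lt (x : ApexEdge G → R) {i j : ι} (hij : i < j) :
    apexLaplacian G x i j = ∑ p : {p : ι × ι // p.1 < p.2 ∧ G.Adj p.1 p.2},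
      if p.1 = (i, j) then - x (Sum.inr p) else 0 := by
  rw [apexLaplacian, Matrix.mul_apply]
  simp only [mul_diagonal, Fintype.sum_sum_type, transpose_apply, incidence, of_apply, apexSource,
    apexTarget, Sum.elim_inl, Sum.elim_inr]
  rw [Finset.sum_eq_zero fun k _ => ?_, zero_add]
  · refine Finset.sum_congr rfl fun ⟨⟨a, b⟩, hab, hG⟩ _ => ?_
    simp only [Option.some.injEq, Prod.mk.injEq]
    grind
  · obtain rfl | hk := eq_or_ne k i
    · simp [hij.ne]
    · simp [hk]

theorem apexLaplacian_apply_of_adj (x : ApexEdge G → R) {i j : ι} (hij : i < j) (hG : G.Adj i j) :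
    apexLaplacian G x i j = - x (Sum.inr ⟨(i, j), hij, hG⟩) := by
  rw [apexLaplacian_apply_of_lt x hij, Finset.sum_eq_single ⟨(i, j), hij, hG⟩, if_pos rfl]
  · exact fun p _ hp => if_neg fun h => hp (Subtype.ext h)
  · exact fun h => absurd (Finset.mem_univ _) h

theorem apexLaplacian_apply_of_not_adj (x : ApexEdge G → R) {i j : ι} (hij : i ≠ j)
    (hG : ¬ G.Adj i j) : apexLaplacian G x i j = 0 := by
  wlog hlt : i < j generalizing i j
  · rw [← (isSymm_apexLaplacian x).apply]
    exact this hij.symm (fun h => hG h.symm) (hij.lt_or_gt.resolve_left hlt)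
  rw [apexLaplacian_apply_of_lt x hlt]
  refine Finset.sum_eq_zero fun p _ => if_neg fun h => hG ?_
  simpa only [h] using p.2.2

variable (G) in
/-- The edge weights of which a symmetric matrix is the reduced Laplacian. -/
def apexWeights (M : Matrix ι ι R) : ApexEdge G → R :=
  Sum.elim (fun i => ∑ j, M i j) fun p => - M p.1.1 p.1.2

theorem apexWeights_apexLaplacian (x : ApexEdge G → R) :
    apexWeights G (apexLaplacian G x) = x := by
  ext (i | ⟨⟨i, j⟩, hij, hG⟩)
  · exact sum_apexLaplacian x i
  · simp only [apexWeights, Sum.elim_inr, apexLaplacian_apply_of_adj x hij hG, neg_neg]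

theorem apexLaplacian_apexWeights {M : Matrix ι ι R} (hs : M.IsSymm)
    (hM : ∀ i j, i ≠ j → ¬ G.Adj i j → M i j = 0) : apexLaplacian G (apexWeights G M) = M := by
  refine eq_of_isSymm_of_lt_of_sum_eq (isSymm_apexLaplacian _) hs (fun i j hij => ?_)
    fun i => sum_apexLaplacian _ i
  by_cases hG : G.Adj i j
  · simp only [apexLaplacian_apply_of_adj _ hij hG, apexWeights, Sum.elim_inr, neg_neg]
  · rw [apexLaplacian_apply_of_not_adj _ hij.ne hG, hM i j hij.ne hG]

variable (G) in
theorem nondegCount_eq_card_treeSum (K : Type) [Field K] :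
    nondegCount G K =
      Nat.card {x : ApexEdge G → K // treeSum (apexSource G) (apexTarget G) x ≠ 0} := by
  have hdet (x : ApexEdge G → K) : (apexLaplacian G x).det =
      treeSum (apexSource G) (apexTarget G) x := det_laplacian _ _ x
  exact Nat.card_congr
    { toFun := fun M => ⟨apexWeights G M.1, by
        rw [← hdet, apexLaplacian_apexWeights M.2.1 M.2.2.2]
        exact M.2.2.1⟩
      invFun := fun x => ⟨apexLaplacian G x.1, isSymm_apexLaplacian _, hdet x.1 ▸ x.2,
        fun _ _ => apexLaplacian_apply_of_not_adj _⟩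
      left_inv := fun M => Subtype.ext (apexLaplacian_apexWeights M.2.1 M.2.2.2)
      right_inv := fun x => Subtype.ext (apexWeights_apexLaplacian _) }

end Apex

theorem not_forall_isRational_treeSum :
    ¬ ∀ (V E : Type) [Fintype V] [Fintype E] (s t : E → V),
      IsRational fun K _ => Nat.card {x : E → K // treeSum s t x ≠ 0} := fun H =>
  not_forall_isRational_countZo fun n G => by
    classical
    exact (H _ _ (apexSource G) (apexTarget G)).congr fun K _ _ => nondegCount_eq_card_treeSum G K

theorem not_forall_isRational_countX :
    ¬ ∀ (V E : Type) [Finite V] [Finite E] (G : Graph V E) [Fintype G.edgeSet],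
      IsRational (countX G) := fun H =>
  not_forall_isRational_treeSum fun V E _ _ s t => by
    have := Fintype.ofFinite (graphOfEnds s t).edgeSet
    exact (H V E (graphOfEnds s t)).congr fun K _ _ => (countX_graphOfEnds s t K).symm

section DeletionContraction

variable {V E : Type}

theorem Connects.card_le [Fintype V] {s t : E → V} {T : Finset E} (h : Connects s t T) :
    Fintype.card V ≤ T.card + 1 := by
  -- The kernel of the coboundary map consists of the constant functions.
  let δ : (V → ℚ) →ₗ[ℚ] (T → ℚ) :=
    LinearMap.pi fun e => (LinearMap.proj (s e) : (V → ℚ) →ₗ[ℚ] ℚ) - LinearMap.proj (t e)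
  have hconst {g : V → ℚ} (hg : g ∈ LinearMap.ker δ) (v w : V) : g v = g w := by
    refine (h (fun w => g v = g w) (fun e he => ?_) v w).1 rfl
    have hδ : g (s e) - g (t e) = 0 := congrFun hg ⟨e, he⟩
    rw [sub_eq_zero.1 hδ]
  have hker : LinearMap.ker δ ≤ Submodule.span ℚ {1} := by
    intro g hg
    rw [Submodule.mem_span_singleton]
    obtain hV | ⟨⟨v⟩⟩ := isEmpty_or_nonempty V
    · exact ⟨0, Subsingleton.elim _ _⟩
    · exact ⟨g v, funext fun w => by simp [hconst hg v w]⟩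
  have hker_le := (Submodule.finrank_mono hker).trans (finrank_span_le_card _)
  have hrange_le := (LinearMap.range δ).finrank_le
  have hsum := δ.finrank_range_add_finrank_ker
  simp only [Module.finrank_fintype_fun_eq_card, Fintype.card_coe, Set.toFinset_singleton,
    Finset.card_singleton] at hker_le hrange_le hsum
  lia

theorem IsTreeSet.ne_of_mem [Fintype V] {s t : E → V} {T : Finset E} (h : IsTreeSet s t T) {e : E}
    (he : e ∈ T) : s e ≠ t e := by
  classical
  intro hloop
  have hconn : Connects s t (T.erase e) := fun f hf => h.2 f fun e' he' => by
    obtain rfl | hne := eq_or_ne e' e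
    · rw [hloop]
    · exact hf e' (Finset.mem_erase.2 ⟨hne, he'⟩)
  have hle := hconn.card_le
  have hpos := Finset.card_pos.2 ⟨e, he⟩
  rw [Finset.card_erase_of_mem he, ← h.1] at hle
  lia

/-- The inclusion of the edges other than `e`. -/
def otherEdges (e : E) : {f : E // f ≠ e} ↪ E := Function.Embedding.subtype _

theorem notMem_map_otherEdges (e : E) (T : Finset {f : E // f ≠ e}) :
    e ∉ T.map (otherEdges e) := by
  simp [otherEdges]

/-- The set consisting of `e` and the edges in `T`. -/
def consEdge (e : E) (T : Finset {f : E // f ≠ e}) : Finset E :=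
  (T.map (otherEdges e)).cons e (notMem_map_otherEdges e T)

theorem mem_map_otherEdges {e f : E} {T : Finset {f : E // f ≠ e}} :
    f ∈ T.map (otherEdges e) ↔ ∃ h : f ≠ e, ⟨f, h⟩ ∈ T := by
  simp [otherEdges]

theorem mem_consEdge {e f : E} {T : Finset {f : E // f ≠ e}} :
    f ∈ consEdge e T ↔ ∀ h : f ≠ e, ⟨f, h⟩ ∈ T := by
  rw [consEdge, Finset.mem_cons, mem_map_otherEdges]
  tauto

open Classical in
/-- The map to the vertices of the contraction of an edge with the ends `u` and `v`: it identifies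
`v` with `u`. -/
def merge {u v : V} (h : u ≠ v) (w : V) : {w : V // w ≠ v} :=
  if hw : w = v then ⟨u, h⟩ else ⟨w, hw⟩

theorem merge_right {u v : V} (h : u ≠ v) : merge h v = ⟨u, h⟩ := dif_pos rfl

theorem merge_of_ne {u v w : V} (h : u ≠ v) (hw : w ≠ v) : merge h w = ⟨w, hw⟩ := dif_neg hw

theorem connects_contract_iff {s t : E → V} {e : E} (h : s e ≠ t e) (T : Finset {f : E // f ≠ e}) :
    Connects (fun f : {f : E // f ≠ e} => merge h (s f)) (fun f => merge h (t f)) T ↔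
      Connects s t (consEdge e T) := by
  have hmerge {g : V → Prop} (hg : g (s e) ↔ g (t e)) (w : V) : g (merge h w) ↔ g w := by
    obtain rfl | hw := eq_or_ne w (t e)
    · rw [merge_right, hg]
    · rw [merge_of_ne h hw]
  simp only [Connects, consEdge, Finset.forall_mem_cons, Finset.forall_mem_map]
  refine ⟨fun H g ⟨hge, hg⟩ x y => ?_, fun H g hg x y => ?_⟩
  · rw [← hmerge hge x, ← hmerge hge y]
    refine H (fun w => g w) (fun f hf => ?_) _ _
    rw [hmerge hge, hmerge hge]
    exact hg f hf
  · have := H (fun w => g (merge h w)) ⟨by rw [merge_right, merge_of_ne h h], hg⟩ x.1 y.1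
    rwa [merge_of_ne h x.2, merge_of_ne h y.2] at this

theorem isTreeSet_contract_iff [Fintype V] {s t : E → V} {e : E} (h : s e ≠ t e)
    [Fintype {w : V // w ≠ t e}] (T : Finset {f : E // f ≠ e}) :
    IsTreeSet (fun f : {f : E // f ≠ e} => merge h (s f)) (fun f => merge h (t f)) T ↔
      IsTreeSet s t (consEdge e T) := by
  classical
  refine and_congr ?_ (connects_contract_iff h T)
  have hpos : 0 < Fintype.card V := Fintype.card_pos_iff.2 ⟨t e⟩
  rw [consEdge, Finset.card_cons, Finset.card_map, Fintype.card_subtype_compl,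
    Fintype.card_subtype_eq]
  lia

theorem isTreeSet_delete_iff [Fintype V] {s t : E → V} {e : E} (T : Finset {f : E // f ≠ e}) :
    IsTreeSet (fun f : {f : E // f ≠ e} => s f) (fun f => t f) T ↔
      IsTreeSet s t (T.map (otherEdges e)) := by
  rw [IsTreeSet, IsTreeSet, Finset.card_map]
  simp [Connects, otherEdges]

theorem not_isTreeSet_consEdge [Fintype V] {s t : E → V} {e : E} (h : s e = t e)
    (T : Finset {f : E // f ≠ e}) : ¬ IsTreeSet s t (consEdge e T) := fun hT =>
  hT.ne_of_mem (Finset.mem_cons_self _ _) h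

variable {R : Type*}

theorem prod_consEdge [CommMonoid R] (e : E) (x : E → R) (T : Finset {f : E // f ≠ e}) :
    ∏ f ∈ consEdge e T, x f = x e * ∏ f ∈ T, x f := by
  rw [consEdge, Finset.prod_cons, Finset.prod_map]
  rfl

variable [Fintype E]

theorem sum_finset_eq_sum_consEdge_add [AddCommMonoid R] (e : E) [Fintype {f : E // f ≠ e}]
    (F : Finset E → R) :
    ∑ T, F T = ∑ T : Finset {f : E // f ≠ e}, F (consEdge e T) +
      ∑ T : Finset {f : E // f ≠ e}, F (T.map (otherEdges e)) := by
  classical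
  have hcons {T : Finset E} (hT : e ∈ T) : consEdge e (T.subtype (· ≠ e)) = T := by
    ext f
    obtain rfl | hf := eq_or_ne f e <;> simp [mem_consEdge, *]
  have hmap {T : Finset E} (hT : e ∉ T) : (T.subtype (· ≠ e)).map (otherEdges e) = T :=
    Finset.subtype_map_of_mem fun _ hf => ne_of_mem_of_not_mem hf hT
  rw [← Finset.sum_filter_add_sum_filter_not Finset.univ (fun T => e ∈ T)]
  refine congrArg₂ (· + ·) ?_ ?_ <;> symm
  · refine Finset.sum_bij (fun T _ => consEdge e T) (fun T _ => ?_) (fun T _ T' _ h => ?_)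
      (fun T hT => ⟨_, Finset.mem_univ _, hcons (Finset.mem_filter.1 hT).2⟩) fun _ _ => rfl
    · exact Finset.mem_filter.2 ⟨Finset.mem_univ _, Finset.mem_cons_self _ _⟩
    · ext f
      simpa [mem_consEdge, f.2] using Finset.ext_iff.1 h f
  · refine Finset.sum_bij (fun T _ => T.map (otherEdges e)) (fun T _ => ?_)
      (fun T _ T' _ h => Finset.map_injective _ h)
      (fun T hT => ⟨_, Finset.mem_univ _, hmap (Finset.mem_filter.1 hT).2⟩) fun _ _ => rfl
    exact Finset.mem_filter.2 ⟨Finset.mem_univ _, notMem_map_otherEdges e T⟩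

variable [CommSemiring R]

theorem prod_compl_consEdge [DecidableEq E] (e : E) [Fintype {f : E // f ≠ e}]
    {_ : DecidableEq {f : E // f ≠ e}} (x : E → R) (T : Finset {f : E // f ≠ e}) :
    ∏ f ∈ (consEdge e T)ᶜ, x f = ∏ f ∈ Tᶜ, x f := by
  have hcompl : (consEdge e T)ᶜ = Tᶜ.map (otherEdges e) := by
    ext f
    simp only [Finset.mem_compl, mem_consEdge, mem_map_otherEdges, not_forall]
  rw [hcompl, Finset.prod_map]
  rfl

theorem prod_compl_map_otherEdges [DecidableEq E] (e : E) [Fintype {f : E // f ≠ e}]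
    {_ : DecidableEq {f : E // f ≠ e}} (x : E → R) (T : Finset {f : E // f ≠ e}) :
    ∏ f ∈ (T.map (otherEdges e))ᶜ, x f = x e * ∏ f ∈ Tᶜ, x f := by
  have hcompl : (T.map (otherEdges e))ᶜ = consEdge e Tᶜ := by
    ext f
    simp only [Finset.mem_compl, mem_consEdge, mem_map_otherEdges, not_exists]
  rw [hcompl, prod_consEdge]

variable [Fintype V] {s t : E → V} {e : E} [Fintype {f : E // f ≠ e}]

theorem treeSum_of_apply_eq_zero {x : E → R} (hx : x e = 0) :
    treeSum s t x = treeSum (fun f : {f : E // f ≠ e} => s f) (fun f => t f) fun f => x f := by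
  classical
  simp only [treeSum, Finset.sum_filter]
  rw [sum_finset_eq_sum_consEdge_add e, Finset.sum_eq_zero fun T _ => ?_, zero_add]
  · exact Finset.sum_congr rfl fun T _ =>
      if_congr (isTreeSet_delete_iff T).symm (Finset.prod_map T (otherEdges e) x) rfl
  · rw [prod_consEdge, hx, zero_mul, ite_self]

theorem cotreeSum_of_loop (h : s e = t e) (x : E → R) :
    cotreeSum s t x =
      x e * cotreeSum (fun f : {f : E // f ≠ e} => s f) (fun f => t f) fun f => x f := by
  classical
  simp only [cotreeSum, Finset.sum_filter]
  rw [sum_finset_eq_sum_consEdge_add e,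
    Finset.sum_eq_zero fun T _ => if_neg (not_isTreeSet_consEdge h T), zero_add, Finset.mul_sum]
  simp only [mul_ite, mul_zero]
  exact Finset.sum_congr rfl fun T _ =>
    if_congr (isTreeSet_delete_iff T).symm (prod_compl_map_otherEdges e x T) rfl

theorem cotreeSum_of_ne (h : s e ≠ t e) [Fintype {w : V // w ≠ t e}] (x : E → R) :
    cotreeSum s t x =
      cotreeSum (fun f : {f : E // f ≠ e} => merge h (s f)) (fun f => merge h (t f))
          (fun f => x f) +
        x e * cotreeSum (fun f : {f : E // f ≠ e} => s f) (fun f => t f) fun f => x f := by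
  classical
  simp only [cotreeSum, Finset.sum_filter]
  rw [sum_finset_eq_sum_consEdge_add e, Finset.mul_sum]
  simp only [mul_ite, mul_zero]
  exact congrArg₂ (· + ·)
    (Finset.sum_congr rfl fun T _ =>
      if_congr (isTreeSet_contract_iff h T).symm (prod_compl_consEdge e x T) rfl)
    (Finset.sum_congr rfl fun T _ =>
      if_congr (isTreeSet_delete_iff T).symm (prod_compl_map_otherEdges e x T) rfl)

end DeletionContraction

theorem cotreeSum_eq_mul_treeSum_inv {V E K : Type} [Fintype V] [Fintype E] [Field K] (s t : E → V)
    {x : E → K} (hx : ∀ e, x e ≠ 0) : cotreeSum s t x = (∏ e, x e) * treeSum s t x⁻¹ := by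
  classical
  rw [cotreeSum, treeSum, Finset.mul_sum]
  refine Finset.sum_congr rfl fun T _ => ?_
  have hT : ∏ e ∈ T, x e ≠ 0 := Finset.prod_ne_zero_iff.2 fun e _ => hx e
  simp only [Pi.inv_apply]
  rw [Finset.prod_inv_distrib, eq_mul_inv_iff_mul_eq₀ hT]
  convert Finset.prod_compl_mul_prod T x

section Torus

variable {E K : Type} [Field K]

/-- The number of points at which `F` does not vanish, among those whose coordinates in `Z` do not
vanish. -/
def torusCount (F : (E → K) → K) (Z : Finset E) : ℕ :=
  Nat.card {x : E → K // (∀ e ∈ Z, x e ≠ 0) ∧ F x ≠ 0}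

theorem torusCount_empty (F : (E → K) → K) : torusCount F ∅ = Nat.card {x : E → K // F x ≠ 0} := by
  simp [torusCount]

theorem torusCount_zero (Z : Finset E) : torusCount (fun _ : E → K => 0) Z = 0 := by
  simp [torusCount]

theorem card_extend_zero (e : E) (p : ({f : E // f ≠ e} → K) → Prop) :
    Nat.card {x : E → K // p (fun f => x f) ∧ x e = 0} = Nat.card {y // p y} := by
  classical
  let restrict : {x : E → K // p (fun f => x f) ∧ x e = 0} → {y // p y} := fun x =>
    ⟨fun f => x.1 f, x.2.1⟩
  refine Nat.card_eq_of_bijective restrict ⟨fun x x' h => Subtype.ext (funext fun f => ?_), ?_⟩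
  · obtain rfl | hf := eq_or_ne f e
    · rw [x.2.2, x'.2.2]
    · exact congrFun (congrArg Subtype.val h) ⟨f, hf⟩
  · rintro ⟨y, hy⟩
    let x : E → K := (Equiv.funSplitAt e K).symm (0, y)
    have hx : (fun f : {f // f ≠ e} => x f) = y := funext fun f => dif_neg f.2
    exact ⟨⟨x, hx.symm ▸ hy, dif_pos rfl⟩, Subtype.ext hx⟩

theorem torusCount_of_notMem [Finite E] [Finite K] [DecidableEq E] {e : E} {F : (E → K) → K}
    {F' : ({f : E // f ≠ e} → K) → K} (hF : ∀ x : E → K, x e = 0 → F x = F' fun f => x f)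
    {Z : Finset E} (he : e ∉ Z) :
    torusCount F Z = torusCount F (insert e Z) + torusCount F' (Z.subtype (· ≠ e)) := by
  classical
  let p (x : E → K) : Prop := (∀ f ∈ Z, x f ≠ 0) ∧ F x ≠ 0
  have hinsert (x : E → K) : p x ∧ x e ≠ 0 ↔ (∀ f ∈ insert e Z, x f ≠ 0) ∧ F x ≠ 0 := by
    rw [Finset.forall_mem_insert]
    tauto
  have hzero (x : E → K) : p x ∧ x e = 0 ↔
      ((∀ f ∈ Z.subtype (· ≠ e), x f ≠ 0) ∧ F' (fun f => x f) ≠ 0) ∧ x e = 0 := by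
    refine and_congr_left fun hx => and_congr ⟨fun h f hf => ?_, fun h f hf => ?_⟩ (by rw [hF x hx])
    · exact h f (Finset.mem_subtype.1 hf)
    · exact h ⟨f, ne_of_mem_of_not_mem hf he⟩ (Finset.mem_subtype.2 hf)
  have hsplit : Nat.card {x // p x} =
      Nat.card {x // p x ∧ x e = 0} + Nat.card {x // p x ∧ x e ≠ 0} := by
    rw [← Nat.card_congr (Equiv.sumCompl fun x : {x // p x} => x.1 e = 0), Nat.card_sum]
    exact congrArg₂ (· + ·)
      (Nat.card_congr (Equiv.subtypeSubtypeEquivSubtypeInter p fun x => x e = 0))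
      (Nat.card_congr (Equiv.subtypeSubtypeEquivSubtypeInter p fun x => x e ≠ 0))
  rw [torusCount, hsplit, add_comm]
  simp only [hinsert, hzero]
  rw [card_extend_zero e fun y => (∀ f ∈ Z.subtype (· ≠ e), y f ≠ 0) ∧ F' y ≠ 0]
  rfl

theorem torusCount_treeSum_univ {V : Type} [Fintype V] [Fintype E] (s t : E → V) :
    torusCount (treeSum (R := K) s t) Finset.univ =
      torusCount (cotreeSum (R := K) s t) Finset.univ := by
  refine Nat.card_congr ((Equiv.inv (E → K)).subtypeEquiv fun x => ?_)
  simp only [Finset.mem_univ, forall_const, Equiv.inv_apply, Pi.inv_apply, ne_eq, inv_eq_zero]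
  refine and_congr_right fun hx => not_congr ?_
  have hinv (e : E) : x⁻¹ e ≠ 0 := inv_ne_zero (hx e)
  rw [cotreeSum_eq_mul_treeSum_inv s t hinv, inv_inv,
    mul_eq_zero_iff_left (Finset.prod_ne_zero_iff.2 fun e _ => hinv e)]

end Torus

section Kontsevich

variable {P : ((K : Type) → [Field K] → ℕ) → Prop} (hP : IsRationallyClosed P)
  (H : ∀ (V E : Type) [Fintype V] [Fintype E] (s t : E → V),
    P fun K _ => Nat.card {x : E → K // cotreeSum s t x ≠ 0})
include hP H

namespace IsRationallyClosed

theorem torusCount_cotreeSum {V E : Type} [Fintype V] [Fintype E] (s t : E → V)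
    (Z : Finset E) : P fun K _ => torusCount (cotreeSum (R := K) s t) Z := by
  classical
  induction hm : Z.card generalizing V E with
  | zero =>
    obtain rfl := Finset.card_eq_zero.1 hm
    simpa only [torusCount_empty] using H V E s t
  | succ m ih =>
    obtain ⟨e, he⟩ := Finset.card_pos.1 (hm ▸ m.succ_pos : 0 < Z.card)
    have hm' : (Z.erase e).card = m := by rw [Finset.card_erase_of_mem he, hm, Nat.add_sub_cancel]
    obtain h | h := eq_or_ne (s e) (t e)
    · refine hP.congr (ih s t (Z.erase e) hm') fun K _ _ => ?_
      have hzero (x : E → K) (hx : x e = 0) : cotreeSum s t x = 0 := by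
        rw [cotreeSum_of_loop h, hx, zero_mul]
      rw [torusCount_of_notMem (F' := fun _ => 0) hzero (Finset.notMem_erase e Z), torusCount_zero,
        Finset.insert_erase he, add_zero]
    · have hcontract {K : Type} [Field K] (x : E → K) (hx : x e = 0) : cotreeSum s t x =
          cotreeSum (fun f : {f : E // f ≠ e} => merge h (s f)) (fun f => merge h (t f))
            fun f => x f := by
        rw [cotreeSum_of_ne h, hx, zero_mul, add_zero]
      have hm'' : ((Z.erase e).subtype (· ≠ e)).card = m := by
        rw [Finset.card_subtype, Finset.filter_true_of_mem fun f => Finset.ne_of_mem_erase, hm']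
      refine hP.of_add_right (hP.congr (ih s t (Z.erase e) hm') fun K _ _ => ?_)
        (ih (fun f : {f : E // f ≠ e} => merge h (s f)) (fun f => merge h (t f)) _ hm'')
      rw [torusCount_of_notMem hcontract (Finset.notMem_erase e Z), Finset.insert_erase he]

theorem torusCount_treeSum {V E : Type} [Fintype V] [Fintype E] (s t : E → V)
    (Z : Finset E) : P fun K _ => torusCount (treeSum (R := K) s t) Z := by
  classical
  induction hm : Zᶜ.card generalizing E with
  | zero =>
    obtain rfl : Z = Finset.univ := by rwa [Finset.card_eq_zero, Finset.compl_eq_empty_iff] at hm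
    simpa only [torusCount_treeSum_univ] using hP.torusCount_cotreeSum H s t Finset.univ
  | succ m ih =>
    obtain ⟨e, he⟩ := Finset.card_pos.1 (hm ▸ m.succ_pos : 0 < Zᶜ.card)
    have hm' : (insert e Z)ᶜ.card = m := by
      rw [Finset.compl_insert, Finset.card_erase_of_mem he, hm, Nat.add_sub_cancel]
    have hm'' : (Z.subtype (· ≠ e))ᶜ.card = m := by
      rw [← hm', ← Finset.card_map (otherEdges e)]
      congr 1
      ext f
      simp [otherEdges, and_comm]
    rw [Finset.mem_compl] at he
    refine hP.congr (hP.add (ih s t (insert e Z) hm') (ih (fun f : {f : E // f ≠ e} => s f)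
      (fun f => t f) (Z.subtype (· ≠ e)) (by convert hm''))) fun K _ _ => ?_
    exact torusCount_of_notMem (fun x hx => treeSum_of_apply_eq_zero hx) he

end IsRationallyClosed

omit hP H

theorem not_forall_isRational_countY :
    ¬ ∀ (V E : Type) [Finite V] [Finite E] (G : Graph V E) [Fintype G.edgeSet],
      IsRational (countY G) := by
  intro H
  refine not_forall_isRational_treeSum fun V E _ _ s t => ?_
  have hcotree (V E : Type) [Fintype V] [Fintype E] (s t : E → V) :
      IsRational fun K _ => Nat.card {x : E → K // cotreeSum s t x ≠ 0} := by
    have := Fintype.ofFinite (graphOfEnds s t).edgeSet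
    exact (H V E (graphOfEnds s t)).congr fun K _ _ => (countY_graphOfEnds s t K).symm
  exact (isRationallyClosed_isRational.torusCount_treeSum hcotree s t ∅).congr fun K _ _ =>
    (torusCount_empty _).symm

end Kontsevich

section DiagonalPoints

open Submodule

variable {ι F K V W : Type*} [Field F] [AddCommGroup V] [Module F V] [Field K] [AddCommGroup W]
  [Module K W]

theorem sum_smul_mem_span_image_compl_iff [Fintype ι] {a : ι → W} (ha : LinearIndependent K a)
    (c : ι → K) (i : ι) : ∑ j, c j • a j ∈ span K (a '' {i}ᶜ) ↔ c i = 0 := by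
  classical
  have hrest : ∑ j ∈ Finset.univ.erase i, c j • a j ∈ span K (a '' {i}ᶜ) :=
    sum_mem fun j hj => smul_mem _ _ (subset_span ⟨j, Finset.ne_of_mem_erase hj, rfl⟩)
  have hi : a i ∉ span K (a '' {i}ᶜ) := ha.notMem_span_image fun h => h rfl
  rw [← Finset.add_sum_erase _ _ (Finset.mem_univ i), Submodule.add_mem_iff_left _ hrest]
  refine ⟨fun h => ?_, fun h => by rw [h, zero_smul]; exact zero_mem _⟩
  by_contra hc
  exact hi ((smul_mem_iff _ hc).1 h)

theorem linearIndependent_sum_sub_iff [Fintype ι] {a : ι → W} (ha : LinearIndependent K a) :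
    LinearIndependent K (fun i => ∑ j, a j - a i) ↔ (Fintype.card ι : K) ≠ 1 := by
  have hsum (g : ι → K) : ∑ i, g i • (∑ j, a j - a i) = ∑ i, (∑ j, g j - g i) • a i := by
    simp only [smul_sub, sub_smul, Finset.sum_sub_distrib, ← Finset.sum_smul, ← Finset.smul_sum]
  rw [Fintype.linearIndependent_iff]
  refine ⟨fun h hcard => ?_, fun hcard g hg => ?_⟩
  · have hzero := h (fun _ => 1) (by
      rw [hsum]
      simp [hcard])
    obtain ⟨i⟩ : Nonempty ι := by
      by_contra! hempty
      simp at hcard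
    exact one_ne_zero (hzero i)
  · have hconst (i : ι) : ∑ j, g j = g i :=
      sub_eq_zero.1 (Fintype.linearIndependent_iff.1 ha _ ((hsum g).symm.trans hg) i)
    have hmul : ((Fintype.card ι : K) - 1) * ∑ j, g j = 0 := by
      rw [sub_one_mul, ← nsmul_eq_mul, ← Finset.card_univ, ← Finset.sum_const, sub_eq_zero]
      exact Finset.sum_congr rfl fun i _ => hconst i
    intro i
    rw [← hconst i]
    exact (mul_eq_zero.1 hmul).resolve_left (sub_ne_zero.2 hcard)

variable (K) in
/-- The vectors `a i` and `o` represent a projective frame, and `d i` represents the intersection of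
the line through `a i` and `o` with the hyperplane through the other `a j`. -/
structure IsFrameWithDiagonal (a : ι → W) (o : W) (d : ι → W) : Prop where
  linearIndependent : LinearIndependent K a
  mem_span_range : o ∈ span K (Set.range a)
  notMem_span_image (i : ι) : o ∉ span K (a '' {i}ᶜ)
  diagonal_mem_span_image (i : ι) : d i ∈ span K (a '' {i}ᶜ)
  diagonal_mem_span_pair (i : ι) : d i ∈ span K {a i, o}
  diagonal_ne_zero (i : ι) : d i ≠ 0

theorem IsFrameWithDiagonal.linearIndependent_diagonal_iff [Fintype ι] {a d : ι → W} {o : W}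
    (h : IsFrameWithDiagonal K a o d) : LinearIndependent K d ↔ (Fintype.card ι : K) ≠ 1 := by
  obtain ⟨c, hc⟩ := (mem_span_range_iff_exists_fun K).1 h.mem_span_range
  have hc0 (i : ι) : c i ≠ 0 := by
    rw [Ne, ← sum_smul_mem_span_image_compl_iff h.linearIndependent c i, hc]
    exact h.notMem_span_image i
  let b : ι → W := fun i => c i • a i
  have hb : LinearIndependent K b := h.linearIndependent.units_smul fun i => Units.mk0 (c i) (hc0 i)
  have hd (i : ι) : ∃ β : K, d i = β • (∑ j, b j - b i) := by
    classical
    obtain ⟨α, β, hαβ⟩ := mem_span_pair.1 (h.diagonal_mem_span_pair i)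
    have hcoord : d i = ∑ j, ((Pi.single i α : ι → K) j + β * c j) • a j := by
      simp only [add_smul, mul_smul, Finset.sum_add_distrib, ← Finset.smul_sum, hc, ← hαβ]
      simp [Pi.single_apply, ite_smul]
    have hzero := h.diagonal_mem_span_image i
    rw [hcoord, sum_smul_mem_span_image_compl_iff h.linearIndependent] at hzero
    have hα : α + β * c i = 0 := by simpa using hzero
    refine ⟨β, ?_⟩
    rw [hc, ← hαβ, eq_neg_of_add_eq_zero_left hα]
    simp only [b, neg_smul, mul_smul, smul_sub]
    abel
  choose β hβ using hd
  have hβ0 (i : ι) : β i ≠ 0 := fun hi => h.diagonal_ne_zero i (by rw [hβ, hi, zero_smul])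
  have hsmul : d = (fun i => Units.mk0 (β i) (hβ0 i)) • fun i => ∑ j, b j - b i :=
    _root_.funext hβ
  rw [hsmul, LinearIndependent.units_smul_iff, linearIndependent_sum_sub_iff hb]

theorem isFrameWithDiagonal_single [Finite ι] [DecidableEq ι] [Nontrivial ι] :
    IsFrameWithDiagonal F (fun i : ι => Pi.single i (1 : F)) 1 fun i => 1 - Pi.single i 1 := by
  have := Fintype.ofFinite ι
  have hli := Pi.linearIndependent_single_one ι F
  have hmem (c : ι → F) (i : ι) :
      c ∈ span F ((fun j : ι => Pi.single j (1 : F)) '' {i}ᶜ) ↔ c i = 0 := by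
    rw [← sum_smul_mem_span_image_compl_iff hli, ← pi_eq_sum_univ' c]
  refine ⟨hli, ?_, fun i => ?_, fun i => ?_, fun i => ?_, fun i => ?_⟩
  · exact (mem_span_range_iff_exists_fun F).2 ⟨1, (pi_eq_sum_univ' 1).symm⟩
  · simp [hmem]
  · simp [hmem]
  · exact mem_span_pair.2 ⟨-1, 1, by module⟩
  · obtain ⟨j, hj⟩ := exists_ne i
    exact fun h => one_ne_zero (by simpa [hj] using congrFun h j : (1 : F) = 0)

variable {α : Type*} {v : α → V} {w : α → W}

theorem mem_span_image_iff_finrank_insert_eq [Finite α] (v : α → V) (e : α) (X : Set α) :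
    v e ∈ span F (v '' X) ↔
      Module.finrank F (span F (v '' insert e X)) = Module.finrank F (span F (v '' X)) := by
  rw [Set.image_insert_eq]
  have : FiniteDimensional F (span F (insert (v e) (v '' X))) :=
    .span_of_finite F (Set.Finite.insert _ (Set.toFinite _))
  refine ⟨fun h => by rw [span_insert_eq_span h], fun h => ?_⟩
  rw [eq_of_le_of_finrank_eq (span_mono (Set.subset_insert (v e) (v '' X))) h.symm]
  exact subset_span (Set.mem_insert _ _)

theorem linearIndependent_comp_iff_of_mem_span_iff
    (h : ∀ e X, w e ∈ span K (w '' X) ↔ v e ∈ span F (v '' X)) (p : ι → α) :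
    LinearIndependent K (w ∘ p) ↔ LinearIndependent F (v ∘ p) := by
  rw [linearIndependent_iff_notMem_span, linearIndependent_iff_notMem_span]
  refine forall_congr' fun i => not_congr ?_
  rw [Set.image_comp, Set.image_comp, Function.comp_apply, Function.comp_apply, h]

theorem IsFrameWithDiagonal.of_mem_span_iff
    (h : ∀ e X, w e ∈ span K (w '' X) ↔ v e ∈ span F (v '' X)) {p r : ι → α} {q : α}
    (hv : IsFrameWithDiagonal F (v ∘ p) (v q) (v ∘ r)) :
    IsFrameWithDiagonal K (w ∘ p) (w q) (w ∘ r) where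
  linearIndependent := (linearIndependent_comp_iff_of_mem_span_iff h p).2 hv.linearIndependent
  mem_span_range := by
    rw [Set.range_comp, h, ← Set.range_comp]
    exact hv.mem_span_range
  notMem_span_image i := by
    rw [Set.image_comp, h, ← Set.image_comp]
    exact hv.notMem_span_image i
  diagonal_mem_span_image i := by
    rw [Set.image_comp, Function.comp_apply, h, ← Set.image_comp]
    exact hv.diagonal_mem_span_image i
  diagonal_mem_span_pair i := by
    have := hv.diagonal_mem_span_pair i
    simp only [Function.comp_apply, ← Set.image_pair] at this ⊢
    exact (h _ _).2 this
  diagonal_ne_zero i := by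
    have h0 := (h (r i) ∅).not
    simp only [Set.image_empty, span_empty, mem_bot] at h0
    exact h0.2 (hv.diagonal_ne_zero i)

end DiagonalPoints

section VectorMatroid

variable {α F K W : Type} [Finite α] [Field F] [AddCommGroup W] [Module F W] [Field K]

theorem vectorMatroid_indep_iff {v : α → W} {I : Set α} :
    (vectorMatroid F v).Indep I ↔ LinearIndepOn F v I := Iff.rfl

theorem eRk_vectorMatroid (v : α → W) (X : Set α) :
    (vectorMatroid F v).eRk X = Module.finrank F (Submodule.span F (v '' X)) := by
  obtain ⟨I, hI⟩ := (vectorMatroid F v).exists_isBasis X (Set.subset_univ X)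
  have hli : LinearIndepOn F v I := hI.indep
  have hspan : Submodule.span F (v '' X) = Submodule.span F (v '' I) := by
    refine le_antisymm (Submodule.span_le.2 ?_) (Submodule.span_mono (Set.image_mono hI.subset))
    rintro _ ⟨e, he, rfl⟩
    by_cases heI : e ∈ I
    · exact Submodule.subset_span ⟨e, heI, rfl⟩
    · by_contra hv
      exact heI (hI.mem_of_insert_indep he (hli.insert hv))
  have := Fintype.ofFinite I
  have hcard := finrank_span_eq_card (R := F) (b := fun i : I => v i) hli
  rw [hI.eRk_eq_encard, hspan, Set.image_eq_range, hcard,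
    ← Nat.card_eq_fintype_card, Nat.card_coe_set_eq, (Set.toFinite I).cast_ncard_eq]

theorem vectorMatroid_algebraMap_comp [Algebra F K] {ι : Type} [Finite ι] (v : α → ι → F) :
    vectorMatroid K (fun e => algebraMap F K ∘ v e) = vectorMatroid F v :=
  Matroid.ext_indep rfl fun I _ => by
    rw [vectorMatroid_indep_iff, vectorMatroid_indep_iff]
    exact linearIndependent_algebraMap_comp_iff (v := fun e : I => v e)

theorem nonempty_representation_vectorMatroid {s : ℕ} (v : α → Fin s → F) :
    Nonempty (Representation (vectorMatroid F v) s F) :=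
  ⟨fun e => v e, fun X => by rw [eRk_vectorMatroid, Set.image_image]⟩

end VectorMatroid

theorem countRepresentations_ne_zero_iff {α : Type} [Finite α] (M : Matroid α) (K : Type) [Field K]
    [Finite K] : countRepresentations M K ≠ 0 ↔ IsRepresentable M K := by
  have : Finite (Representation M (rank M) K) := by
    unfold Representation
    infer_instance
  rw [countRepresentations, IsRepresentable, Ne, Finite.card_eq_zero_iff, not_isEmpty_iff]

theorem span_range_projectivizationRep (K V : Type*) [DivisionRing K] [AddCommGroup V]
    [Module K V] : Submodule.span K (Set.range (Projectivization.rep (K := K) (V := V))) = ⊤ := by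
  refine Submodule.eq_top_iff'.2 fun u => ?_
  by_cases hu : u = 0
  · exact hu ▸ Submodule.zero_mem _
  · obtain ⟨a, ha⟩ := Projectivization.exists_smul_eq_mk_rep K u hu
    rw [← inv_smul_eq_iff.2 ha.symm]
    exact Submodule.smul_mem _ _ (Submodule.subset_span ⟨_, rfl⟩)

theorem projectivizationRep_mk {K V : Type*} [DivisionRing K] [Subsingleton Kˣ] [AddCommGroup V]
    [Module K V] (u : V) (hu : u ≠ 0) : (Projectivization.mk K u hu).rep = u := by
  obtain ⟨a, ha⟩ := Projectivization.exists_smul_eq_mk_rep K u hu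
  rw [← ha, Subsingleton.elim a 1, one_smul]

section FanoMatroid

variable (K : Type) [Field K]

theorem eRank_fanoMatroid : fanoMatroid.eRank = 3 := by
  rw [← Matroid.eRk_univ_eq, fanoMatroid, eRk_vectorMatroid, Set.image_univ,
    span_range_projectivizationRep, finrank_top, Module.finrank_fin_fun]
  rfl

theorem rank_fanoMatroid : rank fanoMatroid = 3 := by
  rw [rank, eRank_fanoMatroid]
  rfl

theorem isRepresentable_fanoMatroid [CharP K 2] : IsRepresentable fanoMatroid K := by
  let := ZMod.algebra K 2
  rw [IsRepresentable, rank_fanoMatroid, fanoMatroid, ← vectorMatroid_algebraMap_comp (K := K)]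
  exact nonempty_representation_vectorMatroid _

variable {K} in
theorem charP_two_of_isRepresentable_fanoMatroid (h : IsRepresentable fanoMatroid K) :
    CharP K 2 := by
  rw [IsRepresentable, rank_fanoMatroid] at h
  obtain ⟨f, hf⟩ := h
  let v (p : fanoMatroid.E) : Fin 3 → ZMod 2 := p.1.rep
  have hspan (e : fanoMatroid.E) (X : Set fanoMatroid.E) :
      f e ∈ Submodule.span K (f '' X) ↔ v e ∈ Submodule.span (ZMod 2) (v '' X) := by
    have hrank (Y : Set fanoMatroid.E) : Module.finrank K (Submodule.span K (f '' Y)) =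
        Module.finrank (ZMod 2) (Submodule.span (ZMod 2) (v '' Y)) := by
      rw [← Nat.cast_inj (R := ℕ∞), hf Y]
      exact (eRk_vectorMatroid _ _).trans (by rw [Set.image_image])
    rw [mem_span_image_iff_finrank_insert_eq, mem_span_image_iff_finrank_insert_eq, hrank, hrank]
  let point (u : Fin 3 → ZMod 2) (hu : u ≠ 0) : fanoMatroid.E :=
    ⟨Projectivization.mk (ZMod 2) u hu, trivial⟩
  have hpoint (u hu) : v (point u hu) = u := projectivizationRep_mk u hu
  let a (i : Fin 3) := point (Pi.single i 1) (by decide +revert)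
  let o := point 1 one_ne_zero
  let d (i : Fin 3) := point (1 - Pi.single i 1) (by decide +revert)
  have hv : IsFrameWithDiagonal (ZMod 2) (v ∘ a) (v o) (v ∘ d) := by
    convert isFrameWithDiagonal_single (ι := Fin 3) (F := ZMod 2) using 1 <;>
      simp only [Function.comp_def, a, o, d, hpoint]
  have hdiag := linearIndependent_comp_iff_of_mem_span_iff hspan d
  rw [hv.linearIndependent_diagonal_iff, (hv.of_mem_span_iff hspan).linearIndependent_diagonal_iff]
    at hdiag
  have hthree : (3 : K) = 1 := by
    simpa using not_iff_not.1 hdiag |>.2 (by decide)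
  exact CharTwo.of_one_ne_zero_of_two_eq_zero one_ne_zero (by linear_combination hthree)

theorem isRepresentable_fanoMatroid_iff : IsRepresentable fanoMatroid K ↔ CharP K 2 :=
  ⟨charP_two_of_isRepresentable_fanoMatroid, fun _ => isRepresentable_fanoMatroid K⟩

theorem not_isRational_countRepresentations_fanoMatroid :
    ¬ IsRational (countRepresentations fanoMatroid) :=
  not_isRational_of_ne_zero_iff_charP 2 fun K _ _ => by
    rw [countRepresentations_ne_zero_iff, isRepresentable_fanoMatroid_iff]

end FanoMatroid

theorem charP_iff_dvd_card (p : ℕ) [Fact p.Prime] (K : Type*) [Field K] [Finite K] :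
    CharP K p ↔ p ∣ Nat.card K := by
  have := Fintype.ofFinite K
  rw [Nat.card_eq_fintype_card, ← prime_dvd_char_iff_dvd_card,
    Nat.prime_dvd_prime_iff_eq Fact.out (CharP.char_is_prime K _), eq_comm, ringChar.eq_iff]

end PointCount

end

open PointCount in
theorem mainTheorem4_general :
    (¬ ∀ (n : ℕ) (G : SimpleGraph (Fin n)), IsRational (countZo G)) ∧
    (¬ ∀ (V E : Type) [Finite V] [Finite E] (G : Graph V E) [Fintype G.edgeSet],
      IsRational (countX G)) ∧
    (¬ ∀ (V E : Type) [Finite V] [Finite E] (G : Graph V E) [Fintype G.edgeSet],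
      IsRational (countY G)) ∧
    fanoMatroid.eRank = 3 ∧
    (∀ (K : Type) [Field K], IsRepresentable fanoMatroid K ↔ CharP K 2) ∧
    ¬ IsRational (countRepresentations fanoMatroid) :=
  ⟨not_forall_isRational_countZo, not_forall_isRational_countX, not_forall_isRational_countY,
    eRank_fanoMatroid, isRepresentable_fanoMatroid_iff,
    not_isRational_countRepresentations_fanoMatroid⟩

/-- The conjectures of Stembridge, Stanley and Kontsevich are false, even if polynomials with
rational coefficients are allowed. The Fano matroid has rank `3`, it is representable over the
finite field with `q` elements if and only if `2 ∣ q`, and the number of its representations is not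
a rational function of `q`. -/
theorem mainTheorem4 :
    ¬ PointCount.StembridgeConjecture ℚ ∧
    ¬ PointCount.StanleyConjecture ℚ ∧
    ¬ PointCount.KontsevichConjecture ℚ ∧
    PointCount.fanoMatroid.eRank = 3 ∧
    (∀ (K : Type) [Field K] [Finite K],
      PointCount.IsRepresentable PointCount.fanoMatroid K ↔ 2 ∣ Nat.card K) ∧
    ¬ PointCount.IsRational (PointCount.countRepresentations PointCount.fanoMatroid) := by
  obtain ⟨hZo, hX, hY, hrank, hrep, hcount⟩ := mainTheorem4_general
  exact ⟨fun h => hZo fun n G => (h n G).isRational,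
    fun h => hX fun V E _ _ G _ => (h V E G).isRational,
    fun h => hY fun V E _ _ G _ => (h V E G).isRational,
    hrank, fun K _ _ => (hrep K).trans (PointCount.charP_iff_dvd_card 2 K), hcount⟩
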